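/- Conventions. On $\mathbb{R}^2$ let $\hat f(\xi)=\int e^{-ix\cdot\xi}f(x)\,dx$ (extended to $L^2$), $\widehat{(-\Delta)^s f}=|\xi|^{2s}\hat f$, $\nabla^\perp=(\partial_2,-\partial_1)$ and $\|f\|_{H^3}^2=(2\pi)^{-2}\int(1+|\xi|^2)^3|\hat f(\xi)|^2\,d\xi$. Let $\mu>0$, $0\le\alpha<\frac12$ and $\sigma\in\{-\frac12,\frac12\}$ ($\sigma=-\frac12$ is the velocity law of the surface quasi-geostrophic equation). For an initial temperature $\Theta_0$ put $\Theta(t)=e^{-\mu t(-\Delta)^\alpha}\Theta_0$, that is, $\partial_t\Theta+\mu(-\Delta)^\alpha\Theta=0$, $\Theta|_{t=0}=\Theta_0$, and $U=\nabla^\perp(-\Delta)^{\sigma}\Theta$, $U_0=\nabla^\perp(-\Delta)^{\sigma}\Theta_0$. For a function $g_0$ and constants $C,\epsilon>0$ consider the condition $$\Big(\|g_0\|_{H^3}^2+\int_0^\infty\|U\cdot\nabla\Theta\|_{H^3}\,dt\Big)\exp\Big(C\Big(\int_0^\infty\big(\|U\|_{L^\infty}+\|\Theta\|_{L^\infty}\big)dt+\int_0^\infty\|U\cdot\nabla\Theta\|_{H^3}\,dt\Big)\Big)\le\epsilon.\qquad(*)$$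 Statement. Let $\mu>0$ and $0<C\le 40\mu$. There is $\delta_0>0$, depending only on $\mu$ and $C$, such that the following holds for all $0<\delta\le\delta_0$, all $\alpha\in[0,\frac12)$ and both values of $\sigma$. Let $\chi\in C^\infty(\mathbb{R}^2)\cap L^2(\mathbb{R}^2)$ be real-valued with $\hat\chi(-\xi)=\hat\chi(\xi)$, $0\le\hat\chi\le1$, $\hat\chi(\xi)=1$ for $|\xi_1-\xi_2|\le\frac13\delta$, $\frac43\le|\xi|\le\frac32$, and $\hat\chi$ supported in $\{|\xi_1-\xi_2|\le\delta,\ \frac43\le|\xi|\le\frac32\}$ (almost everywhere, since $\hat\chi\in L^2$). Let $\Theta_0=\delta^{-1}(\log|\log\delta|)\,\chi$ and $\epsilon=\delta^{1/2}|\log\delta|^2$. If $g_0\in H^3(\mathbb{R}^2)$ is real-valued and $\|g_0\|_{H^3}^2\le\delta^{1/2}$, then $\epsilon\in(0,e^{-100}]$ and $(*)$ holds, all quantities in it being finite. Moreover $$\|U_0\|_{L^\infty},\ \|\Theta_0\|_{L^\infty}\ \ge\ \tfrac1{5000}\log|\log\delta|,\qquad \|U_0\|_{L^2},\ \|\Theta_0\|_{L^2}\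 \ge\ \tfrac1{100}\,\delta^{-1/2}\log|\log\delta|.$$ In particular the data can be arbitrarily large: for every $K$ there are $\delta\in(0,\delta_0]$ and a function $\chi$ as above for which these four norms are all at least $K$, for both values of $\sigma$. -/

import Mathlib

open MeasureTheory Set
open scoped ENNReal FourierTransform ContDiff

noncomputable section

namespace SQG

/-- The Euclidean plane `ℝ²`. -/
abbrev Plane : Type := EuclideanSpace ℝ (Fin 2)

open Classical in
/-- The Fourier transform `f̂(ξ) = ∫ e^{-i x·ξ} f(x) dx` of a real function `f ∈ L²(ℝ²)`, in the
sense of Plancherel (defined up to null sets; `0` if `f ∉ L²`). Mathlib's transform has the kernel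
`e^{-2πi x·ξ}`, hence the rescaling of the frequency. -/
def hat (f : Plane → ℝ) : Plane → ℂ :=
  if h : MemLp (fun x => (f x : ℂ)) 2 (volume : Measure Plane) then
    fun ξ => (𝓕 (h.toLp (fun x => (f x : ℂ))) : Lp ℂ 2 (volume : Measure Plane))
      ((2 * Real.pi)⁻¹ • ξ)
  else 0

/-- The Fourier multiplier with real symbol `m`:
`x ↦ (2π)⁻² ∫ e^{i x·ξ} m(ξ) f̂(ξ) dξ`, for `f ∈ L²` with `m f̂` integrable (for instance, `f̂`
supported in an annulus and `m` bounded there). The symbols below are even and `f` is real, so the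
integral is real and taking the real part changes nothing. -/
def multiplier (m : Plane → ℝ) (f : Plane → ℝ) (x : Plane) : ℝ :=
  ((2 * Real.pi) ^ 2)⁻¹ *
    (∫ ξ : Plane, Complex.exp (Complex.I * (inner ℝ x ξ : ℝ)) * (m ξ : ℂ) * hat f ξ).re

/-- `(-Δ)^s`, with symbol `|ξ|^{2s}`. -/
def fracLaplacian (s : ℝ) (f : Plane → ℝ) : Plane → ℝ :=
  multiplier (fun ξ => ‖ξ‖ ^ (2 * s)) f

/-- `e^{-μ t (-Δ)^α} f`, the solution at time `t` of `∂ₜΘ + μ (-Δ)^α Θ = 0`, `Θ|_{t=0} = f`. -/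
def linearFlow (μ α : ℝ) (f : Plane → ℝ) (t : ℝ) : Plane → ℝ :=
  multiplier (fun ξ => Real.exp (-(μ * t * ‖ξ‖ ^ (2 * α)))) f

/-- The partial derivative `∂ᵢ f`. -/
def partialDeriv (i : Fin 2) (f : Plane → ℝ) (x : Plane) : ℝ :=
  fderiv ℝ f x (EuclideanSpace.single i 1)

/-- The velocity `∇^⊥ (-Δ)^σ f` with `∇^⊥ = (∂₂, -∂₁)`. -/
def velocity (σ : ℝ) (f : Plane → ℝ) (x : Plane) : Plane :=
  !₂[partialDeriv 1 (fracLaplacian σ f) x, -partialDeriv 0 (fracLaplacian σ f) x]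

/-- The transport term `V · ∇f`. -/
def transport (V : Plane → Plane) (f : Plane → ℝ) (x : Plane) : ℝ :=
  ∑ i : Fin 2, V x i * partialDeriv i f x

open Classical in
/-- The norm of the Sobolev space `H^s(ℝ²)`, `s ≥ 0`:
`‖f‖_{H^s}² = (2π)⁻² ∫ (1 + |ξ|²)^s |f̂(ξ)|² dξ`, infinite if `f ∉ H^s`. -/
def sobolevNorm (s : ℝ) (f : Plane → ℝ) : ℝ≥0∞ :=
  if MemLp f 2 (volume : Measure Plane) then
    (ENNReal.ofReal ((2 * Real.pi) ^ 2)⁻¹ *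
      ∫⁻ ξ : Plane, ENNReal.ofReal ((1 + ‖ξ‖ ^ 2) ^ s * ‖hat f ξ‖ ^ 2)) ^ (1 / 2 : ℝ)
  else ⊤

/-- `∫₀^∞ ‖U, Θ‖_{L^∞} dt` for `Θ = e^{-μt(-Δ)^α} Θ₀` and `U = ∇^⊥(-Δ)^σ Θ`. -/
def supIntegral (μ α σ : ℝ) (Θ₀ : Plane → ℝ) : ℝ≥0∞ :=
  ∫⁻ t in Ioi (0 : ℝ),
    (eLpNorm (velocity σ (linearFlow μ α Θ₀ t)) ⊤ (volume : Measure Plane) +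
      eLpNorm (linearFlow μ α Θ₀ t) ⊤ (volume : Measure Plane))

/-- `∫₀^∞ ‖U·∇Θ‖_{H³} dt` for `Θ = e^{-μt(-Δ)^α} Θ₀` and `U = ∇^⊥(-Δ)^σ Θ`. -/
def transportIntegral (μ α σ : ℝ) (Θ₀ : Plane → ℝ) : ℝ≥0∞ :=
  ∫⁻ t in Ioi (0 : ℝ),
    sobolevNorm 3 (transport (velocity σ (linearFlow μ α Θ₀ t)) (linearFlow μ α Θ₀ t))

/-- The smallness condition
`(‖g₀‖²_{H³} + ∫₀^∞ ‖U·∇Θ‖_{H³} dt) exp(C(∫₀^∞ ‖U,Θ‖_{L^∞} dt + ∫₀^∞ ‖U·∇Θ‖_{H³} dt)) ≤ ε`,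
all the quantities in it being finite. -/
def SmallnessCondition (C ε μ α σ : ℝ) (Θ₀ g₀ : Plane → ℝ) : Prop :=
  sobolevNorm 3 g₀ ≠ ⊤ ∧ supIntegral μ α σ Θ₀ ≠ ⊤ ∧ transportIntegral μ α σ Θ₀ ≠ ⊤ ∧
    ((sobolevNorm 3 g₀).toReal ^ 2 + (transportIntegral μ α σ Θ₀).toReal) *
      Real.exp (C * ((supIntegral μ α σ Θ₀).toReal + (transportIntegral μ α σ Θ₀).toReal)) ≤ ε

/-- The part `|ξ₁ - ξ₂| ≤ w` of the annulus `4/3 ≤ |ξ| ≤ 3/2`. -/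
def strip (w : ℝ) : Set Plane :=
  {ξ | |ξ 0 - ξ 1| ≤ w ∧ 4 / 3 ≤ ‖ξ‖ ∧ ‖ξ‖ ≤ 3 / 2}

/-- `χ` is smooth and square integrable, and `χ̂` is an even cut-off function (real, with values in
`[0, 1]`) that equals `1` on the strip of parameter `δ/3` and is supported in the strip of
parameter `δ`. As `χ̂ ∈ L²`, these conditions are understood almost everywhere. -/
structure IsStripCutoff (δ : ℝ) (χ : Plane → ℝ) : Prop where
  smooth : ContDiff ℝ ∞ χ
  memLp : MemLp χ 2 (volume : Measure Plane)
  even : ∀ᵐ ξ : Plane, hat χ (-ξ) = hat χ ξ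
  cutoff : ∀ᵐ ξ : Plane, (hat χ ξ).im = 0 ∧ 0 ≤ (hat χ ξ).re ∧ (hat χ ξ).re ≤ 1
  eq_one : ∀ᵐ ξ : Plane, ξ ∈ strip (δ / 3) → hat χ ξ = 1
  eq_zero : ∀ᵐ ξ : Plane, ξ ∉ strip δ → hat χ ξ = 0

/-- The initial temperature `δ⁻¹ (log |log δ|) χ`. -/
def initialTemp (δ : ℝ) (χ : Plane → ℝ) (x : Plane) : ℝ :=
  δ⁻¹ * Real.log |Real.log δ| * χ x

end SQG

end

/-!
The Fourier transform of `∇^⊥ g · ∇ f` at `ζ` is an integral of `(ξ × η) ĝ(ξ) f̂(η)` over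
`ξ + η = ζ`. Two frequencies `ξ` and `η` in the strip of width `δ` about the diagonal are almost
parallel, so `ξ × η = O(δ)`. As the strip has area `O(δ)`, data whose Fourier transform is at most
`a = δ⁻¹ log |log δ|` have a transport term whose Fourier transform is `O(δ² a²)` and lives on a set
of area `O(δ)`; its `H³` norm is `O(δ^{1/2} (log |log δ|)²)`. The sup norms are of size
`log |log δ|`, with a constant so small that the exponential factor is a power of `|log δ|` with
exponent less than `2`. All frequencies are at least `1`, so the flow decays like `e^{-μt}` and each
time integral costs a factor `1 / μ`. The lower bounds come from a single point at which all
frequencies contribute with the same sign, and from Plancherel's theorem.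
-/

noncomputable section

namespace SQG

open scoped Real ComplexConjugate
open Complex (I)

/-! ### The inverse Fourier transform -/

section FourierInv

variable {V : Type*} [NormedAddCommGroup V] [InnerProductSpace ℝ V] [FiniteDimensional ℝ V]
  [MeasurableSpace V] [BorelSpace V] {F G : V → ℂ}

theorem integral_mul_fourierInv (hF : Integrable F) (hG : Integrable G) :
    ∫ x, F x * 𝓕⁻ G x = ∫ x, 𝓕⁻ F x * G x := by
  have hflip : (-innerₗ V).flip = -innerₗ V := by
    ext v w
    simp [real_inner_comm]
  have h := VectorFourier.integral_fourierIntegral_smul_eq_flip (e := Real.fourierChar)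
    (μ := (volume : Measure V)) (ν := (volume : Measure V)) (L := -innerₗ V) (f := F) (g := G)
    Real.continuous_fourierChar (by simpa using! continuous_inner.neg) hF hG
  rw [hflip] at h
  exact h.symm

theorem continuous_fourierInv (hG : Integrable G) : Continuous (𝓕⁻ G) :=
  VectorFourier.fourierIntegral_continuous (L := -innerₗ V) Real.continuous_fourierChar
    (by simpa using! continuous_inner.neg) hG

theorem fourierInv_toLp_ae_eq (h1 : Integrable G) (h2 : MemLp G 2) :
    ((𝓕⁻ (h2.toLp G) : Lp ℂ 2 (volume : Measure V)) : V → ℂ) =ᵐ[volume] 𝓕⁻ G := by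
  -- Both sides define the same distribution: they agree when tested against Schwartz functions.
  refine ae_eq_of_integral_contDiff_smul_eq ((Lp.memLp _).locallyIntegrable (by norm_num))
    (continuous_fourierInv h1).locallyIntegrable fun g hg hgc => ?_
  have hgc' : HasCompactSupport (fun x => (g x : ℂ)) := hgc.comp_left (g := ((↑) : ℝ → ℂ)) rfl
  have hg' : ContDiff ℝ ∞ (fun x => (g x : ℂ)) := Complex.ofRealCLM.contDiff.comp hg
  have hcoe : (⇑(hgc'.toSchwartzMap hg') : V → ℂ) = fun x => (g x : ℂ) := rfl
  have hdistr := congrArg (fun T => T (hgc'.toSchwartzMap hg'))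
    (Lp.fourierInv_toTemperedDistribution_eq (h2.toLp G))
  simp only [TemperedDistribution.fourierInv_apply, Lp.toTemperedDistribution_apply,
    SchwartzMap.fourierInv_coe, hcoe, smul_eq_mul] at hdistr
  simp only [Complex.real_smul]
  calc ∫ x, (g x : ℂ) * (𝓕⁻ (h2.toLp G) : Lp ℂ 2 (volume : Measure V)) x
      = ∫ x, 𝓕⁻ (fun x => (g x : ℂ)) x * h2.toLp G x := hdistr.symm
    _ = ∫ x, 𝓕⁻ (fun x => (g x : ℂ)) x * G x :=
        integral_congr_ae (h2.coeFn_toLp.mono fun x hx => congrArg _ hx)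
    _ = ∫ x, (g x : ℂ) * 𝓕⁻ G x :=
        (integral_mul_fourierInv (hg'.continuous.integrable_of_hasCompactSupport hgc') h1).symm

theorem contDiff_fourierInv {N : ℕ∞}
    (hG : ∀ n : ℕ, n ≤ N → Integrable fun v => ‖v‖ ^ n * ‖G v‖) : ContDiff ℝ N (𝓕⁻ G) := by
  rw [Real.fourierInv_eq_fourier_comp_neg]
  exact Real.contDiff_fourier fun n hn => by simpa using (hG n hn).comp_neg

theorem fderiv_fourierInv_apply (hG : Integrable G) (hG' : Integrable fun v => ‖v‖ * ‖G v‖)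
    (x y : V) :
    fderiv ℝ (𝓕⁻ G) x y = 𝓕⁻ (fun v => 2 * π * I * (inner ℝ v y : ℝ) * G v) x := by
  have hG'' : Integrable fun v => ‖v‖ * ‖G (-v)‖ := by simpa using hG'.comp_neg
  have hint : Integrable (VectorFourier.fourierSMulRight (innerSL ℝ) fun v => G (-v)) := by
    refine (hG''.const_mul (2 * π * ‖innerSL ℝ (E := V)‖)).mono'
      hG.comp_neg.aestronglyMeasurable.fourierSMulRight (.of_forall fun v => ?_)
    exact (VectorFourier.norm_fourierSMulRight_le _ _ _).trans_eq (by ring)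
  rw [Real.fourierInv_eq_fourier_comp_neg, Real.fderiv_fourier hG.comp_neg hG'',
    Real.fourier_continuousLinearMap_apply hint, Real.fourierInv_eq_fourier_comp_neg]
  refine Real.fourier_congr_ae (.of_forall fun v => ?_) x
  simp only [VectorFourier.fourierSMulRight_apply, inner_neg_left, Complex.ofReal_neg,
    Complex.real_smul, smul_eq_mul]
  rw [show innerSL ℝ v y = inner ℝ v y from rfl]
  ring

theorem conj_fourierInv_of_symm (hG : ∀ v, G (-v) = conj (G v)) (x : V) :
    conj (𝓕⁻ G x) = 𝓕⁻ G x := by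
  rw [Real.fourierInv_eq', ← integral_conj, ← integral_neg_eq_self]
  refine integral_congr_ae (.of_forall fun v => ?_)
  simp only [smul_eq_mul, map_mul, ← Complex.exp_conj, Complex.conj_I, Complex.conj_ofReal, hG,
    Complex.conj_conj, inner_neg_left, mul_neg, Complex.ofReal_neg, map_neg, neg_neg, neg_mul]

end FourierInv

/-! ### Functions with a bounded, compactly supported Fourier transform -/

/-- The substitution `ξ = 2π η` between the frequency variable `ξ` of `hat` and the variable `η` of
Mathlib's Fourier transform. -/
def rescale (G : Plane → ℂ) (η : Plane) : ℂ :=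
  G ((2 * π) • η)

/-- The inverse of `hat`. Taking the real part changes nothing for the Fourier transform `G` of a
real function. -/
def invHat (G : Plane → ℂ) (x : Plane) : ℝ :=
  ((2 * π) ^ 2)⁻¹ * (∫ ξ, Complex.exp (I * (inner ℝ x ξ : ℝ)) * G ξ).re

theorem quasiMeasurePreserving_const_smul {r : ℝ} (hr : r ≠ 0) :
    Measure.QuasiMeasurePreserving (fun ξ : Plane => r • ξ) :=
  ⟨measurable_const_smul _, by
    rw [Measure.map_addHaar_smul _ hr]
    exact Measure.smul_absolutelyContinuous⟩

theorem integral_rescale (G : Plane → ℂ) :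
    ∫ η, rescale G η = (((2 * π) ^ 2)⁻¹ : ℝ) * ∫ ξ, G ξ := by
  have h := Measure.integral_comp_smul (volume : Measure Plane) G (2 * π)
  rwa [finrank_euclideanSpace, Fintype.card_fin, abs_of_pos (by positivity), Complex.real_smul] at h

theorem invHat_eq_re_fourierInv (G : Plane → ℂ) (x : Plane) :
    invHat G x = (𝓕⁻ (rescale G) x).re := by
  rw [Real.fourierInv_eq', invHat, ← Complex.re_ofReal_mul, ← integral_rescale]
  congr 2 with η
  simp only [rescale, smul_eq_mul, inner_smul_right, real_inner_comm x η, mul_comm I]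

theorem invHat_congr_ae {F G : Plane → ℂ} (h : F =ᵐ[volume] G) : invHat F = invHat G := by
  funext x
  rw [invHat, invHat, integral_congr_ae (h.mono fun ξ hξ => congrArg _ hξ)]

theorem invHat_ofReal_mul (c : ℝ) (G : Plane → ℂ) (x : Plane) :
    invHat (fun ξ => (c : ℂ) * G ξ) x = c * invHat G x := by
  simp only [invHat, mul_left_comm _ (c : ℂ), integral_const_mul, Complex.re_ofReal_mul]
  ring

theorem norm_exp_I_mul_inner (x ξ : Plane) : ‖Complex.exp (I * (inner ℝ x ξ : ℝ))‖ = 1 := by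
  rw [mul_comm, Complex.norm_exp_ofReal_mul_I]

theorem abs_invHat_le (G : Plane → ℂ) (x : Plane) :
    |invHat G x| ≤ ((2 * π) ^ 2)⁻¹ * ∫ ξ, ‖G ξ‖ := by
  rw [invHat, abs_mul, abs_of_nonneg (by positivity)]
  gcongr
  refine (Complex.abs_re_le_norm _).trans ((norm_integral_le_integral_norm _).trans_eq ?_)
  simp only [norm_mul, norm_exp_I_mul_inner, one_mul]

theorem multiplier_eq_invHat (m f : Plane → ℝ) :
    multiplier m f = invHat fun ξ => (m ξ : ℂ) * hat f ξ := by
  funext x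
  simp only [multiplier, invHat, mul_assoc]

theorem measurable_hat (f : Plane → ℝ) : Measurable (hat f) := by
  unfold hat
  split_ifs with h
  · exact (Lp.stronglyMeasurable _).measurable.comp (measurable_const_smul _)
  · exact measurable_const

/-- Bounded measurable functions of bounded support with the symmetry of the Fourier transform of a
real function. -/
structure IsSymbol (G : Plane → ℂ) : Prop where
  measurable : Measurable G
  bounded : ∃ M, ∀ ξ, ‖G ξ‖ ≤ M
  support : ∃ R, ∀ ξ, R < ‖ξ‖ → G ξ = 0
  symm : ∀ ξ, G (-ξ) = conj (G ξ)

namespace IsSymbol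

variable {F G : Plane → ℂ}

theorem memLp (hG : IsSymbol G) (p : ℝ≥0∞) : MemLp G p volume := by
  obtain ⟨M, hM⟩ := hG.bounded
  obtain ⟨R, hR⟩ := hG.support
  have hsupp : (Metric.closedBall (0 : Plane) R).indicator G = G :=
    indicator_eq_self.2 fun ξ hξ => by
      simpa using not_lt.1 fun h => hξ (hR ξ h)
  rw [← hsupp, memLp_indicator_iff_restrict measurableSet_closedBall]
  have : IsFiniteMeasure (volume.restrict (Metric.closedBall (0 : Plane) R)) :=
    isFiniteMeasure_restrict.2 measure_closedBall_lt_top.ne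
  exact MemLp.of_bound hG.measurable.aestronglyMeasurable M (.of_forall hM)

theorem integrable (hG : IsSymbol G) : Integrable G :=
  memLp_one_iff_integrable.1 (hG.memLp 1)

theorem integrable_exp_mul (hG : IsSymbol G) (x : Plane) :
    Integrable fun ξ => Complex.exp (I * (inner ℝ x ξ : ℝ)) * G ξ :=
  hG.integrable.bdd_mul (c := 1) (by fun_prop) (.of_forall fun ξ => (norm_exp_I_mul_inner x ξ).le)

theorem sub (hF : IsSymbol F) (hG : IsSymbol G) : IsSymbol fun ξ => F ξ - G ξ where
  measurable := hF.measurable.sub hG.measurable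
  bounded := by
    obtain ⟨M, hM⟩ := hF.bounded
    obtain ⟨M', hM'⟩ := hG.bounded
    exact ⟨M + M', fun ξ => (norm_sub_le _ _).trans (add_le_add (hM ξ) (hM' ξ))⟩
  support := by
    obtain ⟨R, hR⟩ := hF.support
    obtain ⟨R', hR'⟩ := hG.support
    exact ⟨max R R', fun ξ h => by
      rw [hR ξ ((le_max_left _ _).trans_lt h), hR' ξ ((le_max_right _ _).trans_lt h), sub_zero]⟩
  symm ξ := by rw [hF.symm, hG.symm, map_sub]

theorem continuous_mul {m : Plane → ℂ} (hG : IsSymbol G) (hm : Continuous m)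
    (hs : ∀ ξ, m (-ξ) = conj (m ξ)) : IsSymbol fun ξ => m ξ * G ξ where
  measurable := hm.measurable.mul hG.measurable
  bounded := by
    obtain ⟨M, hM⟩ := hG.bounded
    obtain ⟨R, hR⟩ := hG.support
    obtain ⟨M', hM'⟩ := (isCompact_closedBall (0 : Plane) R).exists_bound_of_continuousOn
      hm.continuousOn
    refine ⟨|M'| * M, fun ξ => ?_⟩
    have hM0 : 0 ≤ M := (norm_nonneg _).trans (hM ξ)
    rcases lt_or_ge R ‖ξ‖ with h | h
    · rw [hR ξ h, mul_zero, norm_zero]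
      positivity
    · rw [norm_mul]
      gcongr
      exacts [(hM' ξ (by simpa using h)).trans (le_abs_self _), hM ξ]
  support := hG.support.imp fun R hR ξ h => by rw [hR ξ h, mul_zero]
  symm ξ := by rw [hs, hG.symm, map_mul]

theorem coord_mul (hG : IsSymbol G) (i : Fin 2) : IsSymbol fun ξ => I * (ξ i : ℂ) * G ξ :=
  hG.continuous_mul (by fun_prop) fun ξ => by simp

theorem integrable_norm_pow_mul (hG : IsSymbol G) (n : ℕ) :
    Integrable fun ξ => ‖ξ‖ ^ n * ‖G ξ‖ := by
  have h : IsSymbol fun ξ => ((‖ξ‖ ^ n : ℝ) : ℂ) * G ξ :=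
    hG.continuous_mul (by fun_prop) fun ξ => by rw [norm_neg, Complex.conj_ofReal]
  simpa using h.integrable.norm

protected theorem rescale (hG : IsSymbol G) : IsSymbol (rescale G) where
  measurable := hG.measurable.comp (measurable_const_smul _)
  bounded := hG.bounded.imp fun M hM ξ => hM _
  support := by
    obtain ⟨R, hR⟩ := hG.support
    refine ⟨(2 * π)⁻¹ * R, fun ξ h => hR _ ?_⟩
    rwa [norm_smul, Real.norm_of_nonneg (by positivity), ← inv_mul_lt_iff₀ (by positivity)]
  symm ξ := by rw [rescale, rescale, smul_neg, hG.symm]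

theorem ofReal_invHat (hG : IsSymbol G) (x : Plane) : (invHat G x : ℂ) = 𝓕⁻ (rescale G) x := by
  rw [invHat_eq_re_fourierInv]
  exact Complex.conj_eq_iff_re.1 (conj_fourierInv_of_symm hG.rescale.symm x)

theorem contDiff_fourierInv_rescale (hG : IsSymbol G) : ContDiff ℝ ∞ (𝓕⁻ (rescale G)) :=
  contDiff_fourierInv (N := ⊤) fun n _ => hG.rescale.integrable_norm_pow_mul n

theorem contDiff_invHat (hG : IsSymbol G) : ContDiff ℝ ∞ (invHat G) := by
  rw [funext (invHat_eq_re_fourierInv G)]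
  exact Complex.reCLM.contDiff.comp hG.contDiff_fourierInv_rescale

theorem invHat_sub (hF : IsSymbol F) (hG : IsSymbol G) (x : Plane) :
    invHat (fun ξ => F ξ - G ξ) x = invHat F x - invHat G x := by
  simp only [invHat, mul_sub]
  rw [integral_sub (hF.integrable_exp_mul x) (hG.integrable_exp_mul x), Complex.sub_re, mul_sub]

theorem partialDeriv_invHat (hG : IsSymbol G) (i : Fin 2) :
    partialDeriv i (invHat G) = invHat fun ξ => I * (ξ i : ℂ) * G ξ := by
  funext x
  have hdiff : DifferentiableAt ℝ (𝓕⁻ (rescale G)) x :=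
    hG.contDiff_fourierInv_rescale.differentiable (by simp) x
  have hre : HasFDerivAt (invHat G) (Complex.reCLM ∘L fderiv ℝ (𝓕⁻ (rescale G)) x) x := by
    rw [funext (invHat_eq_re_fourierInv G)]
    exact Complex.reCLM.hasFDerivAt.comp x hdiff.hasFDerivAt
  rw [partialDeriv, hre.fderiv, ContinuousLinearMap.comp_apply, Complex.reCLM_apply,
    fderiv_fourierInv_apply hG.rescale.integrable
      (by simpa using hG.rescale.integrable_norm_pow_mul 1), invHat_eq_re_fourierInv]
  refine congrArg Complex.re (congrFun (congrArg _ (funext fun η => ?_)) x)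
  rw [EuclideanSpace.inner_single_right]
  simp only [rescale, PiLp.smul_apply, smul_eq_mul, Complex.ofReal_mul, Complex.ofReal_ofNat,
    conj_trivial, one_mul]
  ring

theorem ofReal_invHat_ae_eq (hG : IsSymbol G) :
    (fun x => (invHat G x : ℂ)) =ᵐ[volume]
      (𝓕⁻ ((hG.rescale.memLp 2).toLp _) : Lp ℂ 2 (volume : Measure Plane)) := by
  filter_upwards [fourierInv_toLp_ae_eq hG.rescale.integrable (hG.rescale.memLp 2)] with x hx
  rw [hx, hG.ofReal_invHat]

theorem memLp_ofReal_invHat (hG : IsSymbol G) : MemLp (fun x => (invHat G x : ℂ)) 2 volume :=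
  (memLp_congr_ae hG.ofReal_invHat_ae_eq).2 (Lp.memLp _)

theorem memLp_invHat (hG : IsSymbol G) : MemLp (invHat G) 2 volume :=
  hG.memLp_ofReal_invHat.re

theorem toLp_ofReal_invHat (hG : IsSymbol G) :
    hG.memLp_ofReal_invHat.toLp _ = 𝓕⁻ ((hG.rescale.memLp 2).toLp _) :=
  Lp.ext (hG.memLp_ofReal_invHat.coeFn_toLp.trans hG.ofReal_invHat_ae_eq)

theorem hat_invHat (hG : IsSymbol G) : hat (invHat G) =ᵐ[volume] G := by
  have hfourier : ((𝓕 (hG.memLp_ofReal_invHat.toLp _) : Lp ℂ 2 (volume : Measure Plane)) :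
      Plane → ℂ) =ᵐ[volume] rescale G := by
    rw [hG.toLp_ofReal_invHat, FourierTransform.fourier_fourierInv_eq]
    exact MemLp.coeFn_toLp _
  filter_upwards [(quasiMeasurePreserving_const_smul (r := (2 * π)⁻¹) (by positivity)).ae hfourier]
    with ξ hξ
  rw [hat, dif_pos hG.memLp_ofReal_invHat, hξ, rescale, smul_inv_smul₀ (by positivity)]

theorem eq_invHat_of_hat_ae_eq {f : Plane → ℝ} (hG : IsSymbol G) (hc : Continuous f)
    (h2 : MemLp f 2 volume) (h : hat f =ᵐ[volume] G) : f = invHat G := by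
  have h2' : MemLp (fun x => (f x : ℂ)) 2 (volume : Measure Plane) := h2.ofReal
  have hpi : 2 * π ≠ 0 := by positivity
  have hfourier : 𝓕 (h2'.toLp _) = (hG.rescale.memLp 2).toLp _ := by
    refine Lp.ext (Filter.EventuallyEq.trans ?_ (MemLp.coeFn_toLp _).symm)
    filter_upwards [(quasiMeasurePreserving_const_smul hpi).ae h] with η hη
    rw [rescale, ← hη, hat, dif_pos h2', inv_smul_smul₀ hpi]
  refine (Continuous.ae_eq_iff_eq volume hc hG.contDiff_invHat.continuous).1 ?_
  filter_upwards [h2'.coeFn_toLp, hG.ofReal_invHat_ae_eq] with x hx hx'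
  rw [← hfourier, FourierTransform.fourierInv_fourier_eq, hx] at hx'
  exact_mod_cast hx'.symm

theorem multiplier_invHat (hG : IsSymbol G) (m : Plane → ℝ) :
    multiplier m (invHat G) = invHat fun ξ => (m ξ : ℂ) * G ξ := by
  rw [multiplier_eq_invHat]
  exact invHat_congr_ae (hG.hat_invHat.mono fun ξ hξ => congrArg _ hξ)

theorem eLpNorm_invHat_two (hG : IsSymbol G) :
    eLpNorm (invHat G) 2 volume = eLpNorm (rescale G) 2 volume := by
  have hplancherel : ‖𝓕⁻ ((hG.rescale.memLp 2).toLp _)‖ = ‖(hG.rescale.memLp 2).toLp _‖ :=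
    (Lp.fourierTransformₗᵢ Plane ℂ).symm.norm_map _
  rw [← Lp.enorm_toLp (hG.rescale.memLp 2), ← enorm_norm, ← hplancherel, enorm_norm,
    ← hG.toLp_ofReal_invHat, Lp.enorm_toLp]
  exact eLpNorm_congr_norm_ae (.of_forall fun x => (Complex.norm_real _).symm)

theorem le_eLpNorm_invHat_two (hG : IsSymbol G) {S : Set Plane} (hS : MeasurableSet S) {c : ℝ}
    (hc : 0 ≤ c) (h : ∀ ξ ∈ S, c ≤ ‖G ξ‖) :
    ENNReal.ofReal c * (ENNReal.ofReal ((2 * π) ^ 2)⁻¹ * volume S) ^ (1 / 2 : ℝ) ≤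
      eLpNorm (invHat G) 2 volume := by
  have hvol : volume ((fun η : Plane => (2 * π) • η) ⁻¹' S) =
      ENNReal.ofReal ((2 * π) ^ 2)⁻¹ * volume S := by
    rw [Measure.addHaar_preimage_smul _ (by positivity), finrank_euclideanSpace, Fintype.card_fin,
      abs_of_pos (by positivity)]
  have hind := eLpNorm_indicator_const (μ := volume) (c := c) (p := 2)
    (hS.preimage (measurable_const_smul (2 * π))) (by norm_num) (by norm_num)
  rw [hvol, Real.enorm_of_nonneg hc, ENNReal.toReal_ofNat] at hind
  rw [← hind, hG.eLpNorm_invHat_two]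
  refine eLpNorm_mono fun η => ?_
  rw [norm_indicator_eq_indicator_norm, Real.norm_of_nonneg hc]
  exact indicator_le' (f := fun _ => c) (g := fun η => ‖rescale G η‖) (fun η hη => h _ hη)
    (fun η _ => norm_nonneg _) η

theorem sobolevNorm_invHat_le (hG : IsSymbol G) {T : Set Plane} (hT : MeasurableSet T)
    {s K M : ℝ} (hs : ∀ ξ ∈ T, (1 + ‖ξ‖ ^ 2) ^ s ≤ K) (hM : ∀ ξ ∈ T, ‖G ξ‖ ≤ M)
    (h0 : ∀ ξ ∉ T, G ξ = 0) :
    sobolevNorm s (invHat G) ≤ (ENNReal.ofReal ((2 * π) ^ 2)⁻¹ *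
      (ENNReal.ofReal (K * M ^ 2) * volume T)) ^ (1 / 2 : ℝ) := by
  rw [sobolevNorm, if_pos hG.memLp_invHat]
  gcongr
  rw [← setLIntegral_const, ← lintegral_indicator hT]
  refine lintegral_mono_ae (hG.hat_invHat.mono fun ξ hξ => ?_)
  rw [hξ]
  by_cases hξT : ξ ∈ T
  · rw [indicator_of_mem hξT]
    have hK : 0 ≤ K := (by positivity : (0 : ℝ) ≤ (1 + ‖ξ‖ ^ 2) ^ s).trans (hs ξ hξT)
    gcongr
    exacts [hs ξ hξT, hM ξ hξT]
  · simp [h0 ξ hξT]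

end IsSymbol

/-- The convolution `(2π)⁻² F ⋆ G`, the Fourier transform of a product. -/
def symbolConv (F G : Plane → ℂ) (ζ : Plane) : ℂ :=
  (((2 * π) ^ 2)⁻¹ : ℝ) * ∫ ξ, F ξ * G (ζ - ξ)

namespace IsSymbol

variable {F G : Plane → ℂ}

theorem integrable_mul_comp_sub (hF : IsSymbol F) (hG : IsSymbol G) (ζ : Plane) :
    Integrable fun ξ => F ξ * G (ζ - ξ) := by
  obtain ⟨M, hM⟩ := hG.bounded
  exact hF.integrable.mul_bdd
    (hG.measurable.comp (measurable_const.sub measurable_id)).aestronglyMeasurable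
    (.of_forall fun ξ => hM (ζ - ξ))

protected theorem symbolConv (hF : IsSymbol F) (hG : IsSymbol G) : IsSymbol (symbolConv F G) where
  measurable := by
    have h : Measurable fun p : Plane × Plane => F p.2 * G (p.1 - p.2) :=
      (hF.measurable.comp measurable_snd).mul
        (hG.measurable.comp (measurable_fst.sub measurable_snd))
    exact h.stronglyMeasurable.integral_prod_right.measurable.const_mul _
  bounded := by
    obtain ⟨M, hM⟩ := hG.bounded
    refine ⟨((2 * π) ^ 2)⁻¹ * ∫ ξ, ‖F ξ‖ * M, fun ζ => ?_⟩
    rw [symbolConv, norm_mul, Complex.norm_real, Real.norm_of_nonneg (by positivity)]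
    gcongr
    refine norm_integral_le_of_norm_le (hF.integrable.norm.mul_const M) (.of_forall fun ξ => ?_)
    rw [norm_mul]
    gcongr
    exact hM _
  support := by
    obtain ⟨R, hR⟩ := hF.support
    obtain ⟨R', hR'⟩ := hG.support
    refine ⟨R + R', fun ζ h => ?_⟩
    rw [symbolConv, integral_eq_zero_of_ae (.of_forall fun ξ => ?_), mul_zero]
    rcases lt_or_ge R ‖ξ‖ with h1 | h1
    · simp [hR ξ h1]
    · simp [hR' (ζ - ξ) (by linarith [norm_sub_norm_le ζ ξ])]
  symm ζ := by
    rw [symbolConv, symbolConv, map_mul, Complex.conj_ofReal, ← integral_conj,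
      ← integral_neg_eq_self]
    congr 2 with ξ
    rw [map_mul, ← hF.symm, ← hG.symm, neg_sub_neg, neg_sub]

theorem invHat_symbolConv (hF : IsSymbol F) (hG : IsSymbol G) (x : Plane) :
    invHat (symbolConv F G) x = invHat F x * invHat G x := by
  apply Complex.ofReal_injective
  rw [(hF.symbolConv hG).ofReal_invHat, Complex.ofReal_mul, hF.ofReal_invHat, hG.ofReal_invHat]
  simp only [Real.fourierInv_eq_fourier_neg]
  rw [← Real.fourier_mul_convolution_eq hF.rescale.integrable hG.rescale.integrable]
  refine Real.fourier_congr_ae (.of_forall fun ζ => ?_) _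
  rw [convolution_def, rescale, symbolConv, ← integral_rescale]
  simp only [rescale, ContinuousLinearMap.mul_apply', smul_sub]

end IsSymbol

/-! ### Strips -/

theorem norm_sq_eq_add_sq (ξ : Plane) : ‖ξ‖ ^ 2 = ξ 0 ^ 2 + ξ 1 ^ 2 := by
  rw [EuclideanSpace.real_norm_sq_eq, Fin.sum_univ_two]

theorem volume_band (w : ℝ) {S : Set ℝ} (hS : MeasurableSet S) :
    volume {ξ : Plane | |ξ 0 - ξ 1| ≤ w ∧ ξ 1 ∈ S} = ENNReal.ofReal (2 * w) * volume S := by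
  have hcoord := (volume_preserving_finTwoArrow ℝ).comp
    (EuclideanSpace.volume_preserving_symm_measurableEquiv_toLp (Fin 2))
  set A : Set (ℝ × ℝ) := {p | |p.1 - p.2| ≤ w ∧ p.2 ∈ S}
  have hdiff : Measurable fun p : ℝ × ℝ => |p.1 - p.2| := by fun_prop
  have hA : MeasurableSet A := (hdiff measurableSet_Iic).inter (measurable_snd hS)
  have hslice (y : ℝ) : volume ((fun x => (x, y)) ⁻¹' A) =
      S.indicator (fun _ => ENNReal.ofReal (2 * w)) y := by
    by_cases hy : y ∈ S
    · have hball : (fun x => (x, y)) ⁻¹' A = Metric.closedBall y w := by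
        ext x
        simp [A, hy, Real.dist_eq]
      rw [hball, Real.volume_closedBall, indicator_of_mem hy]
    · have hempty : (fun x => (x, y)) ⁻¹' A = ∅ := by
        ext x
        simp [A, hy]
      rw [hempty, measure_empty, indicator_of_notMem hy]
  calc volume {ξ : Plane | |ξ 0 - ξ 1| ≤ w ∧ ξ 1 ∈ S} = volume A :=
        hcoord.measure_preimage hA.nullMeasurableSet
    _ = ENNReal.ofReal (2 * w) * volume S := by
        rw [Measure.volume_eq_prod, Measure.prod_apply_symm hA]
        simp only [hslice]
        rw [lintegral_indicator hS, setLIntegral_const]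

theorem measurable_abs_apply_sub : Measurable fun ξ : Plane => |ξ 0 - ξ 1| := by
  fun_prop

theorem measurableSet_strip (w : ℝ) : MeasurableSet (strip w) :=
  (measurable_abs_apply_sub measurableSet_Iic).inter (measurable_norm measurableSet_Icc)

theorem neg_mem_strip {w : ℝ} {ξ : Plane} : -ξ ∈ strip w ↔ ξ ∈ strip w := by
  simp only [strip, mem_ofPred_eq, norm_neg, PiLp.neg_apply, neg_sub_neg, abs_sub_comm (ξ 1)]

theorem strip_mono {v w : ℝ} (h : v ≤ w) : strip v ⊆ strip w :=
  fun _ hξ => ⟨hξ.1.trans h, hξ.2⟩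

theorem abs_mem_Icc_of_abs_sub_le {a b w : ℝ} (hw : w ≤ 1 / 1000) (hab : |a - b| ≤ w)
    (hl : 16 / 9 ≤ a ^ 2 + b ^ 2) (hu : a ^ 2 + b ^ 2 ≤ 9 / 4) :
    |a| ∈ Icc (15 / 16 : ℝ) (17 / 16) := by
  have hba : |b| ≤ |a| + 1 / 1000 := by
    linarith [abs_sub_abs_le_abs_sub b a, abs_sub_comm a b]
  have hab' : |a| ≤ |b| + 1 / 1000 := by linarith [abs_sub_abs_le_abs_sub a b]
  rw [← sq_abs a, ← sq_abs b] at hl hu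
  constructor <;> by_contra! h <;> nlinarith [abs_nonneg a, abs_nonneg b]

theorem abs_apply_mem_Icc_of_mem_strip {w : ℝ} (hw : w ≤ 1 / 1000) {ξ : Plane} (hξ : ξ ∈ strip w)
    (i : Fin 2) : |ξ i| ∈ Icc (15 / 16 : ℝ) (17 / 16) := by
  obtain ⟨hdiff, hlow, hup⟩ := hξ
  have hl : 16 / 9 ≤ ξ 0 ^ 2 + ξ 1 ^ 2 := by nlinarith [norm_sq_eq_add_sq ξ]
  have hu : ξ 0 ^ 2 + ξ 1 ^ 2 ≤ 9 / 4 := by nlinarith [norm_sq_eq_add_sq ξ, norm_nonneg ξ]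
  fin_cases i
  · exact abs_mem_Icc_of_abs_sub_le hw hdiff hl hu
  · rw [abs_sub_comm] at hdiff
    rw [add_comm] at hl hu
    exact abs_mem_Icc_of_abs_sub_le hw hdiff hl hu

theorem volume_strip_le {w : ℝ} (hw : w ≤ 1 / 1000) :
    volume (strip w) ≤ ENNReal.ofReal (w / 2) := by
  set S : Set ℝ := Icc (15 / 16) (17 / 16) ∪ Icc (-(17 / 16)) (-(15 / 16))
  have hsub : strip w ⊆ {ξ : Plane | |ξ 0 - ξ 1| ≤ w ∧ ξ 1 ∈ S} := fun ξ hξ => by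
    obtain ⟨h1, h2⟩ := abs_apply_mem_Icc_of_mem_strip hw hξ 1
    refine ⟨hξ.1, ?_⟩
    rcases abs_cases (ξ 1) with ⟨h, _⟩ | ⟨h, _⟩
    · exact .inl ⟨by linarith, by linarith⟩
    · exact .inr ⟨by linarith, by linarith⟩
  have hS : volume S ≤ ENNReal.ofReal (1 / 4) := by
    refine (measure_union_le _ _).trans_eq ?_
    rw [Real.volume_Icc, Real.volume_Icc, ← ENNReal.ofReal_add (by norm_num) (by norm_num)]
    norm_num
  calc volume (strip w) ≤ ENNReal.ofReal (2 * w) * volume S := by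
        rw [← volume_band w (measurableSet_Icc.union measurableSet_Icc)]
        exact measure_mono hsub
    _ ≤ ENNReal.ofReal (2 * w) * ENNReal.ofReal (1 / 4) := by gcongr
    _ = ENNReal.ofReal (w / 2) := by
        rw [← ENNReal.ofReal_mul' (by norm_num)]
        ring_nf

theorem le_volume_strip {w : ℝ} (hw : w ≤ 1 / 1000) :
    ENNReal.ofReal (w / 5) ≤ volume (strip w) := by
  have hsub : {ξ : Plane | |ξ 0 - ξ 1| ≤ w ∧ ξ 1 ∈ Icc (19 / 20 : ℝ) (21 / 20)} ⊆ strip w := by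
    rintro ξ ⟨h, h1, h2⟩
    obtain ⟨h3, h4⟩ := abs_le.1 h
    have hsq := norm_sq_eq_add_sq ξ
    exact ⟨h, (sq_le_sq₀ (by norm_num) (norm_nonneg ξ)).1 (by nlinarith),
      (sq_le_sq₀ (norm_nonneg ξ) (by norm_num)).1 (by nlinarith)⟩
  calc ENNReal.ofReal (w / 5)
      = volume {ξ : Plane | |ξ 0 - ξ 1| ≤ w ∧ ξ 1 ∈ Icc (19 / 20 : ℝ) (21 / 20)} := by
        rw [volume_band w measurableSet_Icc, Real.volume_Icc, ← ENNReal.ofReal_mul' (by norm_num)]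
        ring_nf
    _ ≤ volume (strip w) := measure_mono hsub

/-- A set containing all sums of two elements of `strip w`. -/
def sumStrip (w : ℝ) : Set Plane :=
  {ζ | |ζ 0 - ζ 1| ≤ 2 * w ∧ ‖ζ‖ ≤ 3}

theorem measurableSet_sumStrip (w : ℝ) : MeasurableSet (sumStrip w) :=
  (measurable_abs_apply_sub measurableSet_Iic).inter (measurable_norm measurableSet_Iic)

theorem add_mem_sumStrip {w : ℝ} {ξ η : Plane} (hξ : ξ ∈ strip w) (hη : η ∈ strip w) :
    ξ + η ∈ sumStrip w := by
  refine ⟨?_, (norm_add_le ξ η).trans (by linarith [hξ.2.2, hη.2.2])⟩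
  calc |(ξ + η) 0 - (ξ + η) 1| = |(ξ 0 - ξ 1) + (η 0 - η 1)| := by
        rw [PiLp.add_apply, PiLp.add_apply, add_sub_add_comm]
    _ ≤ 2 * w := (abs_add_le _ _).trans (by linarith [hξ.1, hη.1])

theorem volume_sumStrip_le (w : ℝ) : volume (sumStrip w) ≤ ENNReal.ofReal (24 * w) := by
  have hsub : sumStrip w ⊆ {ζ : Plane | |ζ 0 - ζ 1| ≤ 2 * w ∧ ζ 1 ∈ Icc (-3 : ℝ) 3} :=
    fun ζ hζ => ⟨hζ.1, abs_le.1 ((PiLp.norm_apply_le ζ 1).trans hζ.2)⟩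
  refine (measure_mono hsub).trans_eq ?_
  rw [volume_band _ measurableSet_Icc, Real.volume_Icc, ← ENNReal.ofReal_mul' (by norm_num)]
  ring_nf

theorem inv_two_pi_sq_mem_Icc : ((2 * π) ^ 2)⁻¹ ∈ Icc (1 / 40 : ℝ) (1 / 39) := by
  have h1 := Real.pi_gt_d2
  have h2 := Real.pi_lt_d2
  rw [← one_div]
  exact ⟨one_div_le_one_div_of_le (by positivity) (by nlinarith),
    one_div_le_one_div_of_le (by norm_num) (by nlinarith)⟩

theorem integral_norm_le_of_strip {E : Type*} [NormedAddCommGroup E] {δ b : ℝ}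
    (hδ : δ ∈ Ioc 0 (1 / 1000)) (hb0 : 0 ≤ b) {f : Plane → E}
    (hb : ∀ ξ ∈ strip δ, ‖f ξ‖ ≤ b) (h0 : ∀ ξ ∉ strip δ, f ξ = 0) :
    ∫ ξ, ‖f ξ‖ ≤ b * (δ / 2) := by
  have hvol := volume_strip_le hδ.2
  calc ∫ ξ, ‖f ξ‖ = ∫ ξ in strip δ, ‖f ξ‖ :=
        (setIntegral_eq_integral_of_forall_compl_eq_zero fun ξ hξ => by
          rw [h0 ξ hξ, norm_zero]).symm
    _ ≤ b * volume.real (strip δ) := by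
        refine (Real.le_norm_self _).trans (norm_setIntegral_le_of_norm_le_const
          (hvol.trans_lt ENNReal.ofReal_lt_top) fun ξ hξ => ?_)
        rw [norm_norm]
        exact hb ξ hξ
    _ ≤ b * (δ / 2) := by
        gcongr
        exact ENNReal.toReal_le_of_le_ofReal (by linarith [hδ.1]) hvol

theorem le_integral_of_strip {δ c : ℝ} (hδ : δ ∈ Ioc 0 (1 / 1000)) (hc : 0 ≤ c) {f : Plane → ℝ}
    (hf : Integrable f) (h0 : ∀ ξ, 0 ≤ f ξ) (h : ∀ ξ ∈ strip (δ / 3), c ≤ f ξ) :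
    c * (δ / 15) ≤ ∫ ξ, f ξ := by
  have hδ3 : δ / 3 ≤ 1 / 1000 := by linarith [hδ.1, hδ.2]
  have hfin : volume (strip (δ / 3)) ≠ ⊤ :=
    ((volume_strip_le hδ3).trans_lt ENNReal.ofReal_lt_top).ne
  calc c * (δ / 15) = c * (δ / 3 / 5) := by ring
    _ ≤ c * volume.real (strip (δ / 3)) := by
        gcongr
        exact (ENNReal.ofReal_le_iff_le_toReal hfin).1 (le_volume_strip hδ3)
    _ ≤ ∫ ξ in strip (δ / 3), f ξ :=
        setIntegral_ge_of_const_le_real (measurableSet_strip _) hfin h hf.integrableOn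
    _ ≤ ∫ ξ, f ξ := setIntegral_le_integral hf (.of_forall h0)

theorem abs_invHat_le_of_strip {δ b : ℝ} (hδ : δ ∈ Ioc 0 (1 / 1000)) (hb0 : 0 ≤ b) {G : Plane → ℂ}
    (hb : ∀ ξ ∈ strip δ, ‖G ξ‖ ≤ b) (h0 : ∀ ξ ∉ strip δ, G ξ = 0) (x : Plane) :
    |invHat G x| ≤ b * δ / 78 := by
  calc |invHat G x| ≤ ((2 * π) ^ 2)⁻¹ * ∫ ξ, ‖G ξ‖ := abs_invHat_le G x
    _ ≤ 1 / 39 * (b * (δ / 2)) := by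
        gcongr
        exacts [inv_two_pi_sq_mem_Icc.2, integral_norm_le_of_strip hδ hb0 hb h0]
    _ = b * δ / 78 := by ring

namespace IsSymbol

variable {δ c : ℝ} {G : Plane → ℂ}

theorem le_invHat_of_strip (hG : IsSymbol G) (hδ : δ ∈ Ioc 0 (1 / 1000)) (hc : 0 ≤ c) {x : Plane}
    (h0 : ∀ ξ, 0 ≤ (Complex.exp (I * (inner ℝ x ξ : ℝ)) * G ξ).re)
    (h : ∀ ξ ∈ strip (δ / 3), c ≤ (Complex.exp (I * (inner ℝ x ξ : ℝ)) * G ξ).re) :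
    c * δ / 600 ≤ invHat G x := by
  have hint := hG.integrable_exp_mul x
  have hδ0 := hδ.1
  calc c * δ / 600 = 1 / 40 * (c * (δ / 15)) := by ring
    _ ≤ ((2 * π) ^ 2)⁻¹ * ∫ ξ, (Complex.exp (I * (inner ℝ x ξ : ℝ)) * G ξ).re := by
        gcongr
        exacts [inv_two_pi_sq_mem_Icc.1, le_integral_of_strip hδ hc hint.re h0 h]
    _ = invHat G x := by
        rw [invHat]
        exact congrArg _ (Complex.reCLM.integral_comp_comm hint)

theorem le_eLpNorm_invHat_two_of_strip (hG : IsSymbol G) (hδ : δ ∈ Ioc 0 (1 / 1000)) (hc : 0 ≤ c)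
    (h : ∀ ξ ∈ strip (δ / 3), c ≤ ‖G ξ‖) :
    ENNReal.ofReal (1 / 50 * c * δ ^ (1 / 2 : ℝ)) ≤ eLpNorm (invHat G) 2 volume := by
  have hδ0 := hδ.1
  have hpow : 1 / 50 * δ ^ (1 / 2 : ℝ) ≤ (1 / 40 * (δ / 3 / 5)) ^ (1 / 2 : ℝ) := by
    rw [← Real.sqrt_eq_rpow, ← Real.sqrt_eq_rpow]
    refine Real.le_sqrt_of_sq_le ?_
    rw [mul_pow, Real.sq_sqrt hδ0.le]
    linarith
  calc ENNReal.ofReal (1 / 50 * c * δ ^ (1 / 2 : ℝ))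
      ≤ ENNReal.ofReal (c * (1 / 40 * (δ / 3 / 5)) ^ (1 / 2 : ℝ)) := by
        rw [mul_right_comm, mul_comm]
        gcongr
    _ = ENNReal.ofReal c *
          (ENNReal.ofReal (1 / 40) * ENNReal.ofReal (δ / 3 / 5)) ^ (1 / 2 : ℝ) := by
        rw [ENNReal.ofReal_mul hc, ← ENNReal.ofReal_rpow_of_nonneg (by positivity) (by norm_num),
          ENNReal.ofReal_mul (by norm_num)]
    _ ≤ ENNReal.ofReal c *
          (ENNReal.ofReal ((2 * π) ^ 2)⁻¹ * volume (strip (δ / 3))) ^ (1 / 2 : ℝ) := by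
        gcongr
        exacts [inv_two_pi_sq_mem_Icc.1, le_volume_strip (by linarith [hδ.2])]
    _ ≤ eLpNorm (invHat G) 2 volume := hG.le_eLpNorm_invHat_two (measurableSet_strip _) hc h

end IsSymbol

/-! ### Functions with Fourier transform in a strip -/

/-- Even Fourier transforms supported in the strip of width `δ`, with values in `[0, a]`. -/
structure IsAmplitude (δ a : ℝ) (A : Plane → ℝ) : Prop where
  measurable : Measurable A
  even : ∀ ξ, A (-ξ) = A ξ
  nonneg : ∀ ξ, 0 ≤ A ξ
  le : ∀ ξ, A ξ ≤ a
  eq_zero : ∀ ξ ∉ strip δ, A ξ = 0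

/-- The function whose Fourier transform is `A`. -/
def ofAmplitude (A : Plane → ℝ) : Plane → ℝ :=
  invHat fun ξ => (A ξ : ℂ)

/-- The perpendicular gradient `∇^⊥ = (∂₂, -∂₁)`. -/
def perpGrad (f : Plane → ℝ) (x : Plane) : Plane :=
  !₂[partialDeriv 1 f x, -partialDeriv 0 f x]

theorem velocity_eq_perpGrad (σ : ℝ) (f : Plane → ℝ) :
    velocity σ f = perpGrad (fracLaplacian σ f) :=
  rfl

theorem initialTemp_ofAmplitude (δ : ℝ) (X : Plane → ℝ) :
    initialTemp δ (ofAmplitude X) =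
      ofAmplitude fun ξ => δ⁻¹ * Real.log |Real.log δ| * X ξ := by
  funext x
  simp only [initialTemp, ofAmplitude]
  push_cast
  rw [← Complex.ofReal_inv, ← Complex.ofReal_mul, invHat_ofReal_mul]

theorem rpow_mem_Icc_of_abs_le_one {r s : ℝ} (hr : r ∈ Icc (4 / 3 : ℝ) (3 / 2)) (hs : |s| ≤ 1) :
    r ^ s ∈ Icc (2 / 3 : ℝ) (3 / 2) := by
  have h1 : 1 ≤ r := by linarith [hr.1]
  obtain ⟨hs1, hs2⟩ := abs_le.1 hs
  constructor
  · calc (2 / 3 : ℝ) = (3 / 2)⁻¹ := by norm_num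
      _ ≤ r⁻¹ := by gcongr; exact hr.2
      _ = r ^ (-1 : ℝ) := (Real.rpow_neg_one r).symm
      _ ≤ r ^ s := Real.rpow_le_rpow_of_exponent_le h1 hs1
  · calc r ^ s ≤ r ^ (1 : ℝ) := Real.rpow_le_rpow_of_exponent_le h1 hs2
      _ = r := Real.rpow_one r
      _ ≤ 3 / 2 := hr.2

theorem rpow_two_mul_mem_Icc {r σ : ℝ} (hr : r ∈ Icc (4 / 3 : ℝ) (3 / 2)) (hσ : |σ| ≤ 1 / 2) :
    r ^ (2 * σ) ∈ Icc (2 / 3 : ℝ) (3 / 2) :=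
  rpow_mem_Icc_of_abs_le_one hr (by rw [abs_mul, abs_two]; linarith)

namespace IsAmplitude

variable {δ a b : ℝ} {A B : Plane → ℝ}

theorem bound_nonneg (hA : IsAmplitude δ a A) : 0 ≤ a :=
  (hA.nonneg 0).trans (hA.le 0)

theorem norm_ofReal_le (hA : IsAmplitude δ a A) (ξ : Plane) : ‖(A ξ : ℂ)‖ ≤ a := by
  rw [Complex.norm_real, Real.norm_of_nonneg (hA.nonneg ξ)]
  exact hA.le ξ

theorem isSymbol (hA : IsAmplitude δ a A) : IsSymbol fun ξ => (A ξ : ℂ) where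
  measurable := Complex.measurable_ofReal.comp hA.measurable
  bounded := ⟨a, hA.norm_ofReal_le⟩
  support := ⟨3 / 2, fun ξ h => by
    rw [hA.eq_zero ξ fun hξ => hξ.2.2.not_gt h, Complex.ofReal_zero]⟩
  symm ξ := by rw [hA.even, Complex.conj_ofReal]

theorem radial_mul (hA : IsAmplitude δ a A) {m : ℝ → ℝ} (hm : Measurable m)
    (hmb : ∀ r ∈ Icc (4 / 3 : ℝ) (3 / 2), m r ∈ Icc 0 b) :
    IsAmplitude δ (b * a) fun ξ => m ‖ξ‖ * A ξ where
  measurable := (hm.comp measurable_norm).mul hA.measurable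
  even ξ := by rw [norm_neg, hA.even]
  nonneg ξ := by
    by_cases hξ : ξ ∈ strip δ
    · exact mul_nonneg (hmb _ hξ.2).1 (hA.nonneg ξ)
    · rw [hA.eq_zero ξ hξ, mul_zero]
  le ξ := by
    have hb : 0 ≤ b := nonempty_Icc.1 ⟨_, hmb (4 / 3) ⟨le_rfl, by norm_num⟩⟩
    by_cases hξ : ξ ∈ strip δ
    · exact mul_le_mul (hmb _ hξ.2).2 (hA.le ξ) (hA.nonneg ξ) hb
    · rw [hA.eq_zero ξ hξ, mul_zero]
      exact mul_nonneg hb hA.bound_nonneg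
  eq_zero ξ hξ := by rw [hA.eq_zero ξ hξ, mul_zero]

theorem const_mul (hA : IsAmplitude δ a A) {c : ℝ} (hc : 0 ≤ c) :
    IsAmplitude δ (c * a) fun ξ => c * A ξ :=
  hA.radial_mul (m := fun _ => c) measurable_const fun _ _ => ⟨hc, le_rfl⟩

theorem multiplier_ofAmplitude (hA : IsAmplitude δ a A) (m : Plane → ℝ) :
    multiplier m (ofAmplitude A) = ofAmplitude fun ξ => m ξ * A ξ := by
  simp only [ofAmplitude, hA.isSymbol.multiplier_invHat, Complex.ofReal_mul]

theorem fracLaplacian_ofAmplitude (hA : IsAmplitude δ a A) (σ : ℝ) :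
    fracLaplacian σ (ofAmplitude A) = ofAmplitude fun ξ => ‖ξ‖ ^ (2 * σ) * A ξ :=
  hA.multiplier_ofAmplitude _

theorem rpow_norm_mul (hA : IsAmplitude δ a A) {σ : ℝ} (hσ : |σ| ≤ 1 / 2) :
    IsAmplitude δ (3 / 2 * a) fun ξ => ‖ξ‖ ^ (2 * σ) * A ξ :=
  hA.radial_mul (m := fun r => r ^ (2 * σ)) (by fun_prop) fun r hr =>
    have h := rpow_two_mul_mem_Icc hr hσ
    ⟨by linarith [h.1], h.2⟩

theorem partialDeriv_ofAmplitude (hA : IsAmplitude δ a A) (i : Fin 2) :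
    partialDeriv i (ofAmplitude A) = invHat fun ξ => I * (ξ i : ℂ) * (A ξ : ℂ) :=
  hA.isSymbol.partialDeriv_invHat i

theorem abs_ofAmplitude_le (hA : IsAmplitude δ a A) (hδ : δ ∈ Ioc 0 (1 / 1000)) (x : Plane) :
    |ofAmplitude A x| ≤ a * δ / 78 :=
  abs_invHat_le_of_strip hδ hA.bound_nonneg (fun ξ _ => hA.norm_ofReal_le ξ)
    (fun ξ hξ => by rw [hA.eq_zero ξ hξ, Complex.ofReal_zero]) x

theorem abs_partialDeriv_ofAmplitude_le (hA : IsAmplitude δ a A) (hδ : δ ∈ Ioc 0 (1 / 1000))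
    (i : Fin 2) (x : Plane) : |partialDeriv i (ofAmplitude A) x| ≤ 17 / 16 * a * δ / 78 := by
  have ha := hA.bound_nonneg
  rw [hA.partialDeriv_ofAmplitude]
  refine abs_invHat_le_of_strip hδ (by positivity) (fun ξ hξ => ?_) (fun ξ hξ => ?_) x
  · rw [norm_mul, norm_mul, Complex.norm_I, one_mul, Complex.norm_real]
    gcongr
    exacts [(abs_apply_mem_Icc_of_mem_strip hδ.2 hξ i).2, hA.norm_ofReal_le ξ]
  · rw [hA.eq_zero ξ hξ, Complex.ofReal_zero, mul_zero]

theorem eLpNorm_ofAmplitude_top_le (hA : IsAmplitude δ a A) (hδ : δ ∈ Ioc 0 (1 / 1000)) :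
    eLpNorm (ofAmplitude A) ⊤ volume ≤ ENNReal.ofReal (a * δ / 78) := by
  rw [eLpNorm_exponent_top]
  exact eLpNormEssSup_le_of_ae_bound (.of_forall fun x => hA.abs_ofAmplitude_le hδ x)

theorem eLpNorm_perpGrad_ofAmplitude_top_le (hA : IsAmplitude δ a A)
    (hδ : δ ∈ Ioc 0 (1 / 1000)) :
    eLpNorm (perpGrad (ofAmplitude A)) ⊤ volume ≤ ENNReal.ofReal (8 / 5 * (a * δ / 78)) := by
  rw [eLpNorm_exponent_top]
  refine eLpNormEssSup_le_of_ae_bound (.of_forall fun x => ?_)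
  have hpos : 0 ≤ a * δ / 78 := (abs_nonneg _).trans (hA.abs_ofAmplitude_le hδ x)
  have hcoord (i : Fin 2) :
      partialDeriv i (ofAmplitude A) x ^ 2 ≤ (17 / 16 * (a * δ / 78)) ^ 2 := by
    rw [← sq_abs]
    gcongr
    exact (hA.abs_partialDeriv_ofAmplitude_le hδ i x).trans_eq (by ring)
  refine (sq_le_sq₀ (norm_nonneg _) (by positivity)).1 ?_
  calc ‖perpGrad (ofAmplitude A) x‖ ^ 2
      = partialDeriv 1 (ofAmplitude A) x ^ 2 + partialDeriv 0 (ofAmplitude A) x ^ 2 := by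
        simp [norm_sq_eq_add_sq, perpGrad]
    _ ≤ (8 / 5 * (a * δ / 78)) ^ 2 := by nlinarith [hcoord 0, hcoord 1]

end IsAmplitude

/-! ### The transport term -/

/-- The cross product `ξ × η` in the plane. -/
def cross (ξ η : Plane) : ℝ :=
  ξ 0 * η 1 - ξ 1 * η 0

theorem abs_cross_le_of_mem_strip {w : ℝ} (hw : w ≤ 1 / 1000) {ξ η : Plane} (hξ : ξ ∈ strip w)
    (hη : η ∈ strip w) : |cross ξ η| ≤ 17 / 8 * w := by
  have hw0 : 0 ≤ w := (abs_nonneg _).trans hξ.1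
  calc |cross ξ η| = |(ξ 0 - ξ 1) * η 0 - ξ 0 * (η 0 - η 1)| := by
        rw [cross]
        ring_nf
    _ ≤ |ξ 0 - ξ 1| * |η 0| + |ξ 0| * |η 0 - η 1| := by
        rw [← abs_mul, ← abs_mul]
        exact abs_sub _ _
    _ ≤ w * (17 / 16) + 17 / 16 * w := by
        gcongr
        exacts [hξ.1, (abs_apply_mem_Icc_of_mem_strip hw hη 0).2,
          (abs_apply_mem_Icc_of_mem_strip hw hξ 0).2, hη.1]
    _ = 17 / 8 * w := by ring

/-- The Fourier transform of `∇^⊥ g · ∇ f`, where `B` and `A` are the Fourier transforms of `g` and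
`f`. -/
def transportSymbol (B A : Plane → ℝ) (ζ : Plane) : ℝ :=
  ((2 * π) ^ 2)⁻¹ * ∫ ξ, cross ξ (ζ - ξ) * (B ξ * A (ζ - ξ))

theorem transport_perpGrad (g f : Plane → ℝ) (x : Plane) :
    transport (perpGrad g) f x =
      partialDeriv 1 g x * partialDeriv 0 f x - partialDeriv 0 g x * partialDeriv 1 f x := by
  simp [transport, perpGrad, Fin.sum_univ_two, sub_eq_add_neg]

namespace IsAmplitude

variable {δ a b : ℝ} {A B : Plane → ℝ}

theorem ofReal_transportSymbol (hB : IsAmplitude δ b B) (hA : IsAmplitude δ a A) (ζ : Plane) :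
    (transportSymbol B A ζ : ℂ) =
      symbolConv (fun ξ => I * (ξ 1 : ℂ) * (B ξ : ℂ)) (fun ξ => I * (ξ 0 : ℂ) * (A ξ : ℂ)) ζ -
      symbolConv (fun ξ => I * (ξ 0 : ℂ) * (B ξ : ℂ)) (fun ξ => I * (ξ 1 : ℂ) * (A ξ : ℂ)) ζ := by
  have h10 := (hB.isSymbol.coord_mul 1).integrable_mul_comp_sub (hA.isSymbol.coord_mul 0) ζ
  have h01 := (hB.isSymbol.coord_mul 0).integrable_mul_comp_sub (hA.isSymbol.coord_mul 1) ζ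
  rw [symbolConv, symbolConv, ← mul_sub, ← integral_sub h10 h01, transportSymbol,
    Complex.ofReal_mul, ← integral_complex_ofReal]
  congr 2 with ξ
  simp only [cross]
  push_cast
  linear_combination (ξ 0 * (ζ - ξ) 1 - ξ 1 * (ζ - ξ) 0 : ℂ) * (B ξ * A (ζ - ξ)) * Complex.I_sq

theorem isSymbol_transportSymbol (hB : IsAmplitude δ b B) (hA : IsAmplitude δ a A) :
    IsSymbol fun ζ => (transportSymbol B A ζ : ℂ) := by
  simp only [hB.ofReal_transportSymbol hA]
  exact ((hB.isSymbol.coord_mul 1).symbolConv (hA.isSymbol.coord_mul 0)).sub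
    ((hB.isSymbol.coord_mul 0).symbolConv (hA.isSymbol.coord_mul 1))

theorem transport_perpGrad_ofAmplitude (hB : IsAmplitude δ b B) (hA : IsAmplitude δ a A) :
    transport (perpGrad (ofAmplitude B)) (ofAmplitude A) = ofAmplitude (transportSymbol B A) := by
  funext x
  have hB' := hB.isSymbol.coord_mul
  have hA' := hA.isSymbol.coord_mul
  rw [transport_perpGrad]
  simp only [hB.partialDeriv_ofAmplitude, hA.partialDeriv_ofAmplitude]
  rw [ofAmplitude, funext (hB.ofReal_transportSymbol hA),
    ((hB' 1).symbolConv (hA' 0)).invHat_sub ((hB' 0).symbolConv (hA' 1)),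
    (hB' 1).invHat_symbolConv (hA' 0), (hB' 0).invHat_symbolConv (hA' 1)]

theorem abs_transportSymbol_le (hB : IsAmplitude δ b B) (hA : IsAmplitude δ a A)
    (hδ : δ ∈ Ioc 0 (1 / 1000)) (ζ : Plane) : |transportSymbol B A ζ| ≤ δ ^ 2 * (b * a) / 36 := by
  have hδ0 := hδ.1
  have ha := hA.bound_nonneg
  have hb := hB.bound_nonneg
  have hcross (ξ : Plane) (hξ : ξ ∈ strip δ) :
      ‖cross ξ (ζ - ξ) * (B ξ * A (ζ - ξ))‖ ≤ 17 / 8 * δ * (b * a) := by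
    have hBξ := hB.nonneg ξ
    have hAξ := hA.nonneg (ζ - ξ)
    rw [norm_mul, Real.norm_of_nonneg (mul_nonneg hBξ hAξ), Real.norm_eq_abs]
    by_cases hη : ζ - ξ ∈ strip δ
    · gcongr
      exacts [abs_cross_le_of_mem_strip hδ.2 hξ hη, hB.le ξ, hA.le _]
    · rw [hA.eq_zero _ hη, mul_zero, mul_zero]
      positivity
  have hint := integral_norm_le_of_strip hδ (f := fun ξ => cross ξ (ζ - ξ) * (B ξ * A (ζ - ξ)))
    (by positivity) hcross fun ξ hξ => by rw [hB.eq_zero ξ hξ, zero_mul, mul_zero]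
  rw [transportSymbol, abs_mul, abs_of_nonneg (by positivity)]
  calc ((2 * π) ^ 2)⁻¹ * |∫ ξ, cross ξ (ζ - ξ) * (B ξ * A (ζ - ξ))|
      ≤ 1 / 39 * (17 / 8 * δ * (b * a) * (δ / 2)) := by
        gcongr
        exacts [inv_two_pi_sq_mem_Icc.2, (norm_integral_le_integral_norm _).trans hint]
    _ = 17 / 624 * (δ ^ 2 * (b * a)) := by ring
    _ ≤ δ ^ 2 * (b * a) / 36 := by linarith [show 0 ≤ δ ^ 2 * (b * a) by positivity]

theorem transportSymbol_eq_zero (hB : IsAmplitude δ b B) (hA : IsAmplitude δ a A) {ζ : Plane}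
    (hζ : ζ ∉ sumStrip δ) : transportSymbol B A ζ = 0 := by
  rw [transportSymbol, integral_eq_zero_of_ae (.of_forall fun ξ => ?_), mul_zero]
  by_cases hξ : ξ ∈ strip δ
  · have hη : ζ - ξ ∉ strip δ := fun hη => hζ (by simpa using add_mem_sumStrip hξ hη)
    simp [hA.eq_zero _ hη]
  · simp [hB.eq_zero ξ hξ]

theorem sobolevNorm_transport_le (hB : IsAmplitude δ b B) (hA : IsAmplitude δ a A)
    (hδ : δ ∈ Ioc 0 (1 / 1000)) :
    sobolevNorm 3 (transport (perpGrad (ofAmplitude B)) (ofAmplitude A)) ≤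
      ENNReal.ofReal (δ ^ (1 / 2 : ℝ) * (δ ^ 2 * (b * a))) := by
  have hδ0 := hδ.1
  have hab : 0 ≤ b * a := mul_nonneg hB.bound_nonneg hA.bound_nonneg
  have hweight (ζ : Plane) (hζ : ζ ∈ sumStrip δ) : (1 + ‖ζ‖ ^ 2) ^ (3 : ℝ) ≤ 1000 :=
    calc (1 + ‖ζ‖ ^ 2) ^ (3 : ℝ) ≤ (1 + 3 ^ 2) ^ (3 : ℝ) := by gcongr; exact hζ.2
      _ = 1000 := by norm_num
  rw [hB.transport_perpGrad_ofAmplitude hA]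
  set M := δ ^ 2 * (b * a)
  calc sobolevNorm 3 (ofAmplitude (transportSymbol B A))
      ≤ (ENNReal.ofReal ((2 * π) ^ 2)⁻¹ *
          (ENNReal.ofReal (1000 * (M / 36) ^ 2) * volume (sumStrip δ))) ^ (1 / 2 : ℝ) :=
        (hB.isSymbol_transportSymbol hA).sobolevNorm_invHat_le (measurableSet_sumStrip δ) hweight
          (fun ζ _ => by
            rw [Complex.norm_real]
            exact hB.abs_transportSymbol_le hA hδ ζ)
          (fun ζ hζ => by rw [hB.transportSymbol_eq_zero hA hζ, Complex.ofReal_zero])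
    _ ≤ (ENNReal.ofReal (1 / 39) *
          (ENNReal.ofReal (1000 * (M / 36) ^ 2) * ENNReal.ofReal (24 * δ))) ^ (1 / 2 : ℝ) := by
        gcongr
        exacts [inv_two_pi_sq_mem_Icc.2, volume_sumStrip_le δ]
    _ = ENNReal.ofReal (√(1 / 39 * (1000 * (M / 36) ^ 2 * (24 * δ)))) := by
        rw [← ENNReal.ofReal_mul (by positivity), ← ENNReal.ofReal_mul (by positivity),
          ENNReal.ofReal_rpow_of_nonneg (by positivity) (by positivity), Real.sqrt_eq_rpow]
    _ ≤ ENNReal.ofReal (δ ^ (1 / 2 : ℝ) * M) := by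
        refine ENNReal.ofReal_le_ofReal (Real.sqrt_le_iff.2 ⟨by positivity, ?_⟩)
        rw [← Real.sqrt_eq_rpow, mul_pow, Real.sq_sqrt hδ0.le]
        nlinarith [mul_nonneg (sq_nonneg M) hδ0.le]

end IsAmplitude

/-! ### Cut-off functions as amplitudes -/

section StripCutoff

variable {δ : ℝ} {χ X : Plane → ℝ}

open Classical in
/-- The representative of `hat χ` for which the conditions of `IsStripCutoff δ χ` hold at every
frequency. -/
def cutoffAmplitude (δ : ℝ) (χ : Plane → ℝ) (ξ : Plane) : ℝ :=
  if ξ ∈ strip (δ / 3) then 1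
  else if ξ ∈ strip δ then max 0 (min 1 (((hat χ ξ).re + (hat χ (-ξ)).re) / 2))
  else 0

theorem cutoffAmplitude_of_mem {ξ : Plane} (hξ : ξ ∈ strip (δ / 3)) : cutoffAmplitude δ χ ξ = 1 :=
  if_pos hξ

theorem isAmplitude_cutoffAmplitude (hδ : 0 < δ) (χ : Plane → ℝ) :
    IsAmplitude δ 1 (cutoffAmplitude δ χ) where
  measurable := by
    have hre : Measurable fun ξ => (hat χ ξ).re := Complex.measurable_re.comp (measurable_hat χ)
    exact Measurable.ite (measurableSet_strip _) measurable_const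
      (Measurable.ite (measurableSet_strip _) (measurable_const.max
        (measurable_const.min ((hre.add (hre.comp measurable_neg)).div_const 2))) measurable_const)
  even ξ := by
    classical simp only [cutoffAmplitude, neg_mem_strip, neg_neg, add_comm]
  nonneg ξ := by
    unfold cutoffAmplitude
    split_ifs
    exacts [zero_le_one, le_max_left _ _, le_rfl]
  le ξ := by
    unfold cutoffAmplitude
    split_ifs
    exacts [le_rfl, max_le zero_le_one (min_le_left _ _), zero_le_one]
  eq_zero ξ hξ := by
    rw [cutoffAmplitude, if_neg fun h => hξ (strip_mono (by linarith) h), if_neg hξ]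

theorem IsStripCutoff.hat_ae_eq (hχ : IsStripCutoff δ χ) :
    hat χ =ᵐ[volume] fun ξ => (cutoffAmplitude δ χ ξ : ℂ) := by
  filter_upwards [hχ.even, hχ.cutoff, hχ.eq_one, hχ.eq_zero] with ξ heven hreal hone hzero
  obtain ⟨him, h0, h1⟩ := hreal
  unfold cutoffAmplitude
  split_ifs with hin hout
  · rw [hone hin, Complex.ofReal_one]
  · rw [heven, add_self_div_two, min_eq_right h1, max_eq_right h0]
    exact Complex.ext rfl him
  · rw [hzero hout, Complex.ofReal_zero]

theorem IsStripCutoff.eq_ofAmplitude (hχ : IsStripCutoff δ χ) (hδ : 0 < δ) :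
    χ = ofAmplitude (cutoffAmplitude δ χ) :=
  (isAmplitude_cutoffAmplitude hδ χ).isSymbol.eq_invHat_of_hat_ae_eq hχ.smooth.continuous hχ.memLp
    hχ.hat_ae_eq

theorem IsAmplitude.isStripCutoff (hX : IsAmplitude δ 1 X) (hone : ∀ ξ ∈ strip (δ / 3), X ξ = 1) :
    IsStripCutoff δ (ofAmplitude X) where
  smooth := hX.isSymbol.contDiff_invHat
  memLp := hX.isSymbol.memLp_invHat
  even := by
    filter_upwards [hX.isSymbol.hat_invHat, (Measure.measurePreserving_neg
      volume).quasiMeasurePreserving.ae hX.isSymbol.hat_invHat] with ξ hξ hnegξ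
    rw [ofAmplitude, hξ, hnegξ, hX.even]
  cutoff := by
    filter_upwards [hX.isSymbol.hat_invHat] with ξ hξ
    rw [ofAmplitude, hξ]
    exact ⟨Complex.ofReal_im _, hX.nonneg ξ, hX.le ξ⟩
  eq_one := by
    filter_upwards [hX.isSymbol.hat_invHat] with ξ hξ hmem
    rw [ofAmplitude, hξ, hone ξ hmem, Complex.ofReal_one]
  eq_zero := by
    filter_upwards [hX.isSymbol.hat_invHat] with ξ hξ hmem
    rw [ofAmplitude, hξ, hX.eq_zero ξ hmem, Complex.ofReal_zero]

theorem exists_isStripCutoff (hδ : 0 < δ) : ∃ χ, IsStripCutoff δ χ :=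
  ⟨_, (isAmplitude_cutoffAmplitude hδ 0).isStripCutoff fun _ => cutoffAmplitude_of_mem⟩

end StripCutoff

/-! ### Lower bounds -/

theorem ofReal_abs_le_eLpNorm_top_of_continuous {X : Type*} [TopologicalSpace X]
    [MeasurableSpace X] {ν : Measure X} [ν.IsOpenPosMeasure] {f : X → ℝ} (hf : Continuous f)
    (x : X) : ENNReal.ofReal |f x| ≤ eLpNorm f ⊤ ν := by
  rw [← Real.enorm_eq_ofReal_abs, eLpNorm_exponent_top]
  by_contra! hx
  have hopen : IsOpen {y | eLpNormEssSup f ν < ‖f y‖ₑ} := isOpen_lt continuous_const hf.enorm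
  have hnull : ν {y | eLpNormEssSup f ν < ‖f y‖ₑ} = 0 := by
    simpa only [ae_iff, not_le] using ae_le_eLpNormEssSup (f := f) (μ := ν)
  exact (hopen.measure_pos ν ⟨x, hx⟩).ne' hnull

theorem eLpNorm_partialDeriv_le_perpGrad (f : Plane → ℝ) (p : ℝ≥0∞) :
    eLpNorm (partialDeriv 1 f) p volume ≤ eLpNorm (perpGrad f) p volume :=
  eLpNorm_mono fun x => by simpa [perpGrad] using PiLp.norm_apply_le (perpGrad f x) 0

theorem half_le_sin_mul {s y : ℝ} (hs : s ∈ Icc (15 / 16 : ℝ) (17 / 16)) (hy : 15 / 16 ≤ y) :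
    1 / 2 ≤ Real.sin s * y := by
  have hs0 : 0 ≤ s := by linarith [hs.1]
  have hjordan : 2 / π * s ≤ Real.sin s :=
    Real.mul_le_sin hs0 (by linarith [hs.2, Real.pi_gt_d2])
  have hpi : (5 / 8 : ℝ) ≤ 2 / π := by
    rw [le_div_iff₀ Real.pi_pos]
    linarith [Real.pi_lt_d2]
  calc (1 / 2 : ℝ) ≤ 5 / 8 * (15 / 16) * (15 / 16) := by norm_num
    _ ≤ 2 / π * s * y := by
        gcongr
        exact hs.1
    _ ≤ Real.sin s * y := by gcongr

theorem half_le_sin_mul_of_mem_strip {w : ℝ} (hw : w ≤ 1 / 1000) {ξ : Plane} (hξ : ξ ∈ strip w) :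
    1 / 2 ≤ Real.sin ((ξ 0 + ξ 1) / 2) * ξ 1 := by
  obtain ⟨l0, u0⟩ := abs_apply_mem_Icc_of_mem_strip hw hξ 0
  obtain ⟨l1, u1⟩ := abs_apply_mem_Icc_of_mem_strip hw hξ 1
  obtain ⟨d1, d2⟩ := abs_le.1 hξ.1
  rcases abs_cases (ξ 1) with ⟨h1, _⟩ | ⟨h1, _⟩ <;> rcases abs_cases (ξ 0) with ⟨h0, _⟩ | ⟨h0, _⟩
  · exact half_le_sin_mul ⟨by linarith, by linarith⟩ (by linarith)
  · linarith
  · linarith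
  · have h := half_le_sin_mul (s := -((ξ 0 + ξ 1) / 2)) (y := -ξ 1)
      ⟨by linarith, by linarith⟩ (by linarith)
    rwa [Real.sin_neg, neg_mul_neg] at h

theorem re_exp_mul_I_mul (s y r : ℝ) :
    (Complex.exp (I * (s : ℂ)) * (I * (y : ℂ) * (r : ℂ))).re = -Real.sin s * y * r := by
  rw [mul_comm I (s : ℂ), Complex.exp_mul_I, ← Complex.ofReal_cos, ← Complex.ofReal_sin]
  simp only [Complex.mul_re, Complex.mul_im, Complex.add_re, Complex.add_im, Complex.ofReal_re,
    Complex.ofReal_im, Complex.I_re, Complex.I_im]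
  ring

theorem le_rpow_norm_mul_of_strip {A : Plane → ℝ} {σ c w : ℝ} (hσ : |σ| ≤ 1 / 2) (hc : 0 ≤ c)
    (h : ∀ ξ ∈ strip w, c ≤ A ξ) (ξ : Plane) (hξ : ξ ∈ strip w) :
    2 / 3 * c ≤ ‖ξ‖ ^ (2 * σ) * A ξ :=
  mul_le_mul (rpow_two_mul_mem_Icc hξ.2 hσ).1 (h ξ hξ) hc (by positivity)

namespace IsAmplitude

variable {δ a c σ : ℝ} {A B : Plane → ℝ}

theorem le_eLpNorm_ofAmplitude_top (hA : IsAmplitude δ a A) (hδ : δ ∈ Ioc 0 (1 / 1000))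
    (hc : 0 ≤ c) (h : ∀ ξ ∈ strip (δ / 3), c ≤ A ξ) :
    ENNReal.ofReal (c * δ / 600) ≤ eLpNorm (ofAmplitude A) ⊤ volume := by
  have hpoint : c * δ / 600 ≤ ofAmplitude A 0 := by
    refine hA.isSymbol.le_invHat_of_strip hδ hc (fun ξ => ?_) fun ξ hξ => ?_ <;>
      rw [inner_zero_left, Complex.ofReal_zero, mul_zero, Complex.exp_zero, one_mul,
        Complex.ofReal_re]
    exacts [hA.nonneg ξ, h ξ hξ]
  exact (ENNReal.ofReal_le_ofReal (hpoint.trans (le_abs_self _))).trans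
    (ofReal_abs_le_eLpNorm_top_of_continuous hA.isSymbol.contDiff_invHat.continuous 0)

theorem le_partialDeriv_ofAmplitude (hB : IsAmplitude δ a B) (hδ : δ ∈ Ioc 0 (1 / 1000))
    (hc : 0 ≤ c) (h : ∀ ξ ∈ strip (δ / 3), c ≤ B ξ) :
    c * δ / 1200 ≤ partialDeriv 1 (ofAmplitude B) !₂[-1 / 2, -1 / 2] := by
  have hδ3 : δ / 3 ≤ δ := by linarith [hδ.1]
  have hre (ξ : Plane) : (Complex.exp (I * (inner ℝ (!₂[-1 / 2, -1 / 2] : Plane) ξ : ℝ)) *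
      (I * (ξ 1 : ℂ) * (B ξ : ℂ))).re = Real.sin ((ξ 0 + ξ 1) / 2) * ξ 1 * B ξ := by
    have hinner : inner ℝ (!₂[-1 / 2, -1 / 2] : Plane) ξ = -((ξ 0 + ξ 1) / 2) := by
      simp [PiLp.inner_apply, Fin.sum_univ_two]
      ring
    rw [re_exp_mul_I_mul, hinner, Real.sin_neg, neg_neg]
  have hlow (ξ : Plane) (hξ : ξ ∈ strip δ) :
      1 / 2 * B ξ ≤ Real.sin ((ξ 0 + ξ 1) / 2) * ξ 1 * B ξ :=
    mul_le_mul_of_nonneg_right (half_le_sin_mul_of_mem_strip hδ.2 hξ) (hB.nonneg ξ)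
  rw [hB.partialDeriv_ofAmplitude, show c * δ / 1200 = c / 2 * δ / 600 by ring]
  refine (hB.isSymbol.coord_mul 1).le_invHat_of_strip hδ (by positivity) (fun ξ => ?_)
    fun ξ hξ => ?_ <;> rw [hre]
  · by_cases hξ : ξ ∈ strip δ
    · linarith [hlow ξ hξ, hB.nonneg ξ]
    · rw [hB.eq_zero ξ hξ, mul_zero]
  · linarith [hlow ξ (strip_mono hδ3 hξ), h ξ hξ]

theorem le_eLpNorm_perpGrad_ofAmplitude_top (hB : IsAmplitude δ a B)
    (hδ : δ ∈ Ioc 0 (1 / 1000)) (hc : 0 ≤ c) (h : ∀ ξ ∈ strip (δ / 3), c ≤ B ξ) :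
    ENNReal.ofReal (c * δ / 1200) ≤ eLpNorm (perpGrad (ofAmplitude B)) ⊤ volume := by
  have hcont : Continuous (partialDeriv 1 (ofAmplitude B)) := by
    rw [hB.partialDeriv_ofAmplitude]
    exact (hB.isSymbol.coord_mul 1).contDiff_invHat.continuous
  calc ENNReal.ofReal (c * δ / 1200)
      ≤ ENNReal.ofReal |partialDeriv 1 (ofAmplitude B) !₂[-1 / 2, -1 / 2]| :=
        ENNReal.ofReal_le_ofReal
          ((hB.le_partialDeriv_ofAmplitude hδ hc h).trans (le_abs_self _))
    _ ≤ eLpNorm (partialDeriv 1 (ofAmplitude B)) ⊤ volume :=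
        ofReal_abs_le_eLpNorm_top_of_continuous hcont _
    _ ≤ eLpNorm (perpGrad (ofAmplitude B)) ⊤ volume := eLpNorm_partialDeriv_le_perpGrad _ _

theorem le_eLpNorm_ofAmplitude_two (hA : IsAmplitude δ a A) (hδ : δ ∈ Ioc 0 (1 / 1000))
    (hc : 0 ≤ c) (h : ∀ ξ ∈ strip (δ / 3), c ≤ A ξ) :
    ENNReal.ofReal (1 / 50 * c * δ ^ (1 / 2 : ℝ)) ≤ eLpNorm (ofAmplitude A) 2 volume :=
  hA.isSymbol.le_eLpNorm_invHat_two_of_strip hδ hc fun ξ hξ => by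
    rw [Complex.norm_real]
    exact (h ξ hξ).trans (Real.le_norm_self _)

theorem le_eLpNorm_perpGrad_ofAmplitude_two (hB : IsAmplitude δ a B)
    (hδ : δ ∈ Ioc 0 (1 / 1000)) (hc : 0 ≤ c) (h : ∀ ξ ∈ strip (δ / 3), c ≤ B ξ) :
    ENNReal.ofReal (1 / 50 * (15 / 16 * c) * δ ^ (1 / 2 : ℝ)) ≤
      eLpNorm (perpGrad (ofAmplitude B)) 2 volume := by
  refine le_trans ?_ (eLpNorm_partialDeriv_le_perpGrad _ _)
  rw [hB.partialDeriv_ofAmplitude]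
  refine (hB.isSymbol.coord_mul 1).le_eLpNorm_invHat_two_of_strip hδ (by positivity) fun ξ hξ => ?_
  have hδ3 : δ / 3 ≤ 1 / 1000 := by linarith [hδ.1, hδ.2]
  rw [norm_mul, norm_mul, Complex.norm_I, one_mul, Complex.norm_real, Complex.norm_real,
    Real.norm_eq_abs, Real.norm_of_nonneg (hB.nonneg ξ)]
  gcongr
  exacts [(abs_apply_mem_Icc_of_mem_strip hδ3 hξ 1).1, h ξ hξ]

theorem le_eLpNorm_velocity_top (hA : IsAmplitude δ a A) (hδ : δ ∈ Ioc 0 (1 / 1000))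
    (hσ : |σ| ≤ 1 / 2) (hc : 0 ≤ c) (h : ∀ ξ ∈ strip (δ / 3), c ≤ A ξ) :
    ENNReal.ofReal (c * δ / 1800) ≤ eLpNorm (velocity σ (ofAmplitude A)) ⊤ volume := by
  rw [velocity_eq_perpGrad, hA.fracLaplacian_ofAmplitude,
    show c * δ / 1800 = 2 / 3 * c * δ / 1200 by ring]
  exact (hA.rpow_norm_mul hσ).le_eLpNorm_perpGrad_ofAmplitude_top hδ (by positivity)
    (le_rpow_norm_mul_of_strip hσ hc h)

theorem le_eLpNorm_velocity_two (hA : IsAmplitude δ a A) (hδ : δ ∈ Ioc 0 (1 / 1000))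
    (hσ : |σ| ≤ 1 / 2) (hc : 0 ≤ c) (h : ∀ ξ ∈ strip (δ / 3), c ≤ A ξ) :
    ENNReal.ofReal (1 / 80 * c * δ ^ (1 / 2 : ℝ)) ≤
      eLpNorm (velocity σ (ofAmplitude A)) 2 volume := by
  rw [velocity_eq_perpGrad, hA.fracLaplacian_ofAmplitude,
    show 1 / 80 * c * δ ^ (1 / 2 : ℝ) = 1 / 50 * (15 / 16 * (2 / 3 * c)) * δ ^ (1 / 2 : ℝ) by ring]
  exact (hA.rpow_norm_mul hσ).le_eLpNorm_perpGrad_ofAmplitude_two hδ (by positivity)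
    (le_rpow_norm_mul_of_strip hσ hc h)

end IsAmplitude

/-! ### Time integrals along the linear flow -/

theorem lintegral_exp_decay {b r : ℝ} (hb : 0 ≤ b) (hr : 0 < r) :
    ∫⁻ t in Ioi (0 : ℝ), ENNReal.ofReal (b * Real.exp (-r * t)) = ENNReal.ofReal (b / r) := by
  have hint : IntegrableOn (fun t => b * Real.exp (-r * t)) (Ioi 0) :=
    (integrableOn_exp_mul_Ioi (neg_lt_zero.2 hr) 0).const_mul b
  rw [← ofReal_integral_eq_lintegral_ofReal hint (.of_forall fun t => by positivity),
    integral_const_mul, integral_exp_mul_Ioi (neg_lt_zero.2 hr), mul_zero, Real.exp_zero,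
    neg_div_neg_eq, mul_one_div]

namespace IsAmplitude

variable {δ a μ α σ t : ℝ} {A : Plane → ℝ}

theorem linearFlow_ofAmplitude (hA : IsAmplitude δ a A) (μ α t : ℝ) :
    linearFlow μ α (ofAmplitude A) t =
      ofAmplitude fun ξ => Real.exp (-(μ * t * ‖ξ‖ ^ (2 * α))) * A ξ :=
  hA.multiplier_ofAmplitude _

theorem exp_mul (hA : IsAmplitude δ a A) (hμ : 0 ≤ μ) (hα : 0 ≤ α) (ht : 0 ≤ t) :
    IsAmplitude δ (Real.exp (-μ * t) * a)
      fun ξ => Real.exp (-(μ * t * ‖ξ‖ ^ (2 * α))) * A ξ := by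
  refine hA.radial_mul (m := fun r => Real.exp (-(μ * t * r ^ (2 * α)))) (by fun_prop)
    fun r hr => ⟨(Real.exp_pos _).le, Real.exp_le_exp.2 ?_⟩
  have hone : 1 ≤ r ^ (2 * α) := Real.one_le_rpow (by linarith [hr.1]) (by positivity)
  linarith [le_mul_of_one_le_right (mul_nonneg hμ ht) hone]

theorem supIntegral_le (hA : IsAmplitude δ a A) (hδ : δ ∈ Ioc 0 (1 / 1000)) (hμ : 0 < μ)
    (hα : 0 ≤ α) (hσ : |σ| ≤ 1 / 2) :
    supIntegral μ α σ (ofAmplitude A) ≤ ENNReal.ofReal (7 / 160 * (a * δ) / μ) := by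
  have ha := hA.bound_nonneg
  have hδ0 := hδ.1
  rw [← lintegral_exp_decay (by positivity) hμ]
  refine setLIntegral_mono_ae' measurableSet_Ioi (.of_forall fun t ht => ?_)
  have hflow := hA.exp_mul hμ.le hα (le_of_lt ht)
  rw [hA.linearFlow_ofAmplitude, velocity_eq_perpGrad, hflow.fracLaplacian_ofAmplitude]
  calc _ ≤ ENNReal.ofReal (8 / 5 * (3 / 2 * (Real.exp (-μ * t) * a) * δ / 78)) +
        ENNReal.ofReal (Real.exp (-μ * t) * a * δ / 78) :=
        add_le_add ((hflow.rpow_norm_mul hσ).eLpNorm_perpGrad_ofAmplitude_top_le hδ)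
          (hflow.eLpNorm_ofAmplitude_top_le hδ)
    _ = ENNReal.ofReal (17 / 390 * (a * δ * Real.exp (-μ * t))) := by
        rw [← ENNReal.ofReal_add (by positivity) (by positivity)]
        ring_nf
    _ ≤ ENNReal.ofReal (7 / 160 * (a * δ) * Real.exp (-μ * t)) := by
        have hpos : 0 ≤ a * δ * Real.exp (-μ * t) := by positivity
        exact ENNReal.ofReal_le_ofReal (by linarith)

theorem transportIntegral_le (hA : IsAmplitude δ a A) (hδ : δ ∈ Ioc 0 (1 / 1000)) (hμ : 0 < μ)
    (hα : 0 ≤ α) (hσ : |σ| ≤ 1 / 2) :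
    transportIntegral μ α σ (ofAmplitude A) ≤
      ENNReal.ofReal (3 / 4 * δ ^ (1 / 2 : ℝ) * (a * δ) ^ 2 / μ) := by
  have hδ0 := hδ.1
  rw [show 3 / 4 * δ ^ (1 / 2 : ℝ) * (a * δ) ^ 2 / μ =
      3 / 2 * δ ^ (1 / 2 : ℝ) * (a * δ) ^ 2 / (2 * μ) by ring,
    ← lintegral_exp_decay (by positivity) (by positivity)]
  refine setLIntegral_mono_ae' measurableSet_Ioi (.of_forall fun t ht => ?_)
  have hflow := hA.exp_mul hμ.le hα (le_of_lt ht)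
  rw [hA.linearFlow_ofAmplitude, velocity_eq_perpGrad, hflow.fracLaplacian_ofAmplitude]
  refine ((hflow.rpow_norm_mul hσ).sobolevNorm_transport_le hflow hδ).trans_eq ?_
  rw [show -(2 * μ) * t = -μ * t + -μ * t by ring, Real.exp_add]
  ring_nf

end IsAmplitude

/-! ### Small parameters -/

/-- The parameters `δ` for which the estimates close. -/
structure IsSmallParam (μ δ : ℝ) : Prop where
  mem_Ioc : δ ∈ Ioc 0 (1 / 1000)
  one_le_log : 1 ≤ |Real.log δ|
  eps_le : δ ^ (1 / 2 : ℝ) * |Real.log δ| ^ 2 ≤ Real.exp (-100)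
  growth : (1 + Real.log |Real.log δ| ^ 2 / μ) * Real.exp 1 ≤ |Real.log δ| ^ (1 / 4 : ℝ)

theorem tendsto_abs_log_zero :
    Filter.Tendsto (fun δ : ℝ => |Real.log δ|) (nhdsWithin 0 (Ioi 0)) Filter.atTop :=
  Filter.tendsto_abs_atBot_atTop.comp Real.tendsto_log_nhdsGT_zero

theorem eventually_log_sq_le_rpow (a b : ℝ) {s : ℝ} (hs : 0 < s) :
    ∀ᶠ y : ℝ in Filter.atTop, (1 + Real.log y ^ 2 / a) * b ≤ y ^ s := by
  have hlog : (fun y : ℝ => Real.log y ^ (2 : ℝ)) =o[Filter.atTop] fun y => y ^ s :=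
    isLittleO_log_rpow_rpow_atTop 2 hs
  have hone : (fun _ : ℝ => (1 : ℝ)) =o[Filter.atTop] fun y => y ^ s :=
    Asymptotics.isLittleO_const_left.2 (.inr
      (tendsto_norm_atTop_atTop.comp (tendsto_rpow_atTop hs)))
  have hbound := ((hone.add (hlog.const_mul_left a⁻¹)).const_mul_left b).bound one_pos
  filter_upwards [hbound, Filter.eventually_ge_atTop 0] with y hy hy0
  rw [one_mul, Real.norm_of_nonneg (Real.rpow_nonneg hy0 s)] at hy
  calc (1 + Real.log y ^ 2 / a) * b = b * (1 + a⁻¹ * Real.log y ^ (2 : ℝ)) := by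
        rw [Real.rpow_two]
        ring
    _ ≤ y ^ s := (Real.le_norm_self _).trans hy

theorem tendsto_sqrt_mul_log_sq :
    Filter.Tendsto (fun δ : ℝ => δ ^ (1 / 2 : ℝ) * |Real.log δ| ^ 2) (nhdsWithin 0 (Ioi 0))
      (nhds 0) := by
  have h := ((Real.tendsto_pow_mul_exp_neg_atTop_nhds_zero 2).comp
    (tendsto_abs_log_zero.atTop_mul_const (one_half_pos (α := ℝ)))).const_mul 4
  rw [mul_zero] at h
  refine h.congr' ?_
  filter_upwards [Ioo_mem_nhdsGT one_pos] with δ hδ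
  rw [Function.comp, Real.rpow_def_of_pos hδ.1, abs_of_neg (Real.log_neg hδ.1 hδ.2)]
  ring_nf

theorem eventually_isSmallParam (μ : ℝ) :
    ∀ᶠ δ : ℝ in nhdsWithin 0 (Ioi 0), IsSmallParam μ δ := by
  filter_upwards [Ioc_mem_nhdsGT (show (0 : ℝ) < 1 / 1000 by norm_num),
    tendsto_abs_log_zero.eventually_ge_atTop 1,
    tendsto_sqrt_mul_log_sq.eventually_le_const (Real.exp_pos (-100)),
    tendsto_abs_log_zero.eventually
      (eventually_log_sq_le_rpow μ (Real.exp 1) (show (0 : ℝ) < 1 / 4 by norm_num))]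
    with δ hmem hlog heps hgrowth
  exact ⟨hmem, hlog, heps, hgrowth⟩

namespace IsSmallParam

variable {μ δ C α σ : ℝ} {χ g₀ : Plane → ℝ}

theorem loglog_nonneg (h : IsSmallParam μ δ) : 0 ≤ Real.log |Real.log δ| :=
  Real.log_nonneg h.one_le_log

theorem eps_pos (h : IsSmallParam μ δ) : 0 < δ ^ (1 / 2 : ℝ) * |Real.log δ| ^ 2 :=
  mul_pos (Real.rpow_pos_of_pos h.mem_Ioc.1 _) (pow_pos (one_pos.trans_le h.one_le_log) 2)

theorem sqrt_mul_loglog_sq_le (h : IsSmallParam μ δ) :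
    δ ^ (1 / 2 : ℝ) * Real.log |Real.log δ| ^ 2 ≤ 1 / 30 := by
  have hδ0 := h.mem_Ioc.1
  calc δ ^ (1 / 2 : ℝ) * Real.log |Real.log δ| ^ 2 ≤ δ ^ (1 / 2 : ℝ) * |Real.log δ| ^ 2 := by
        gcongr
        exacts [h.loglog_nonneg, Real.log_le_self (abs_nonneg _)]
    _ ≤ Real.exp (-100) := h.eps_le
    _ = 1 / Real.exp 100 := by rw [Real.exp_neg, one_div]
    _ ≤ 1 / 30 := by
        gcongr
        linarith [Real.add_one_le_exp 100]

theorem smallness_of_le (h : IsSmallParam μ δ) {g S T : ℝ} (hμ : 0 < μ) (hCμ : C ≤ 40 * μ)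
    (hg : g ≤ δ ^ (1 / 2 : ℝ)) (hS0 : 0 ≤ S) (hT0 : 0 ≤ T)
    (hS : S ≤ 7 / 160 * Real.log |Real.log δ| / μ)
    (hT : T ≤ 3 / 4 * δ ^ (1 / 2 : ℝ) * Real.log |Real.log δ| ^ 2 / μ) :
    (g + T) * Real.exp (C * (S + T)) ≤ δ ^ (1 / 2 : ℝ) * |Real.log δ| ^ 2 := by
  have hδ0 := h.mem_Ioc.1
  have hl0 : 0 < |Real.log δ| := one_pos.trans_le h.one_le_log
  have hsmall := h.sqrt_mul_loglog_sq_le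
  have hgrowth := h.growth
  set l := |Real.log δ|
  set L := Real.log l with hL
  have hCS : C * S ≤ 7 / 4 * L :=
    calc C * S ≤ 40 * μ * (7 / 160 * L / μ) := by gcongr
      _ = 7 / 4 * L := by field_simp; ring
  have hCT : C * T ≤ 1 :=
    calc C * T ≤ 40 * μ * (3 / 4 * δ ^ (1 / 2 : ℝ) * L ^ 2 / μ) := by gcongr
      _ = 30 * (δ ^ (1 / 2 : ℝ) * L ^ 2) := by field_simp; ring
      _ ≤ 1 := by linarith
  have hexp : Real.exp (C * (S + T)) ≤ l ^ (7 / 4 : ℝ) * Real.exp 1 := by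
    rw [Real.rpow_def_of_pos hl0, ← Real.exp_add, ← hL]
    exact Real.exp_le_exp.2 (by linarith)
  have hsum : g + T ≤ δ ^ (1 / 2 : ℝ) * (1 + L ^ 2 / μ) := by
    have : 0 ≤ δ ^ (1 / 2 : ℝ) * L ^ 2 / μ := by positivity
    calc g + T ≤ δ ^ (1 / 2 : ℝ) + 3 / 4 * (δ ^ (1 / 2 : ℝ) * L ^ 2 / μ) :=
          add_le_add hg (hT.trans_eq (by ring))
      _ ≤ δ ^ (1 / 2 : ℝ) + δ ^ (1 / 2 : ℝ) * L ^ 2 / μ := by linarith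
      _ = δ ^ (1 / 2 : ℝ) * (1 + L ^ 2 / μ) := by ring
  calc (g + T) * Real.exp (C * (S + T))
      ≤ δ ^ (1 / 2 : ℝ) * (1 + L ^ 2 / μ) * (l ^ (7 / 4 : ℝ) * Real.exp 1) := by gcongr
    _ = δ ^ (1 / 2 : ℝ) * l ^ (7 / 4 : ℝ) * ((1 + L ^ 2 / μ) * Real.exp 1) := by ring
    _ ≤ δ ^ (1 / 2 : ℝ) * l ^ (7 / 4 : ℝ) * l ^ (1 / 4 : ℝ) := by gcongr
    _ = δ ^ (1 / 2 : ℝ) * l ^ 2 := by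
        rw [mul_assoc, ← Real.rpow_add hl0, ← Real.rpow_two]
        norm_num

theorem exists_amplitude (h : IsSmallParam μ δ) (hχ : IsStripCutoff δ χ) :
    ∃ a A, a * δ = Real.log |Real.log δ| ∧ IsAmplitude δ a A ∧ (∀ ξ ∈ strip (δ / 3), A ξ = a) ∧
      initialTemp δ χ = ofAmplitude A := by
  have hδ0 := h.mem_Ioc.1
  have ha : 0 ≤ δ⁻¹ * Real.log |Real.log δ| := mul_nonneg (inv_nonneg.2 hδ0.le) h.loglog_nonneg
  refine ⟨δ⁻¹ * Real.log |Real.log δ|,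
    fun ξ => δ⁻¹ * Real.log |Real.log δ| * cutoffAmplitude δ χ ξ, by field_simp, ?_, ?_, ?_⟩
  · simpa only [mul_one] using (isAmplitude_cutoffAmplitude hδ0 χ).const_mul ha
  · exact fun ξ hξ => by simp only [cutoffAmplitude_of_mem hξ, mul_one]
  · rw [← initialTemp_ofAmplitude, ← hχ.eq_ofAmplitude hδ0]

theorem smallnessCondition (h : IsSmallParam μ δ) (hμ : 0 < μ) (hCμ : C ≤ 40 * μ) (hα : 0 ≤ α)
    (hσ : |σ| ≤ 1 / 2) (hχ : IsStripCutoff δ χ)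
    (hg : sobolevNorm 3 g₀ ^ 2 ≤ ENNReal.ofReal (δ ^ (1 / 2 : ℝ))) :
    SmallnessCondition C (δ ^ (1 / 2 : ℝ) * |Real.log δ| ^ 2) μ α σ (initialTemp δ χ) g₀ := by
  obtain ⟨a, A, haδ, hA, -, hΘ⟩ := h.exists_amplitude hχ
  have hδ0 := h.mem_Ioc.1
  have hL := h.loglog_nonneg
  have hS := hA.supIntegral_le h.mem_Ioc hμ hα hσ
  have hT := hA.transportIntegral_le h.mem_Ioc hμ hα hσ
  rw [haδ, ← hΘ] at hS hT
  have hgtop : sobolevNorm 3 g₀ ≠ ⊤ := fun htop => by simp [htop] at hg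
  refine ⟨hgtop, (hS.trans_lt ENNReal.ofReal_lt_top).ne, (hT.trans_lt ENNReal.ofReal_lt_top).ne,
    h.smallness_of_le hμ hCμ ?_ ENNReal.toReal_nonneg ENNReal.toReal_nonneg
      (ENNReal.toReal_le_of_le_ofReal (by positivity) hS)
      (ENNReal.toReal_le_of_le_ofReal (by positivity) hT)⟩
  rw [← ENNReal.toReal_pow]
  exact ENNReal.toReal_le_of_le_ofReal (by positivity) hg

theorem norm_lower_bounds (h : IsSmallParam μ δ) (hσ : |σ| ≤ 1 / 2) (hχ : IsStripCutoff δ χ) :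
    ENNReal.ofReal (1 / 5000 * Real.log |Real.log δ|) ≤
        eLpNorm (velocity σ (initialTemp δ χ)) ⊤ volume ∧
      ENNReal.ofReal (1 / 100 * δ ^ (-1 / 2 : ℝ) * Real.log |Real.log δ|) ≤
        eLpNorm (velocity σ (initialTemp δ χ)) 2 volume ∧
      ENNReal.ofReal (1 / 5000 * Real.log |Real.log δ|) ≤ eLpNorm (initialTemp δ χ) ⊤ volume ∧
      ENNReal.ofReal (1 / 100 * δ ^ (-1 / 2 : ℝ) * Real.log |Real.log δ|) ≤
        eLpNorm (initialTemp δ χ) 2 volume := by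
  obtain ⟨a, A, haδ, hA, hone, hΘ⟩ := h.exists_amplitude hχ
  have hδ := h.mem_Ioc
  have hδ0 := hδ.1
  have ha := hA.bound_nonneg
  have hlow (ξ : Plane) (hξ : ξ ∈ strip (δ / 3)) : a ≤ A ξ := (hone ξ hξ).ge
  have hsqrt : δ ^ (-1 / 2 : ℝ) * Real.log |Real.log δ| = a * δ ^ (1 / 2 : ℝ) := by
    have hpow : δ ^ (-1 / 2 : ℝ) * δ = δ ^ (1 / 2 : ℝ) := by
      rw [← Real.rpow_add_one hδ0.ne']
      norm_num
    rw [← haδ, ← hpow]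
    ring
  have hpos : 0 ≤ a * δ ^ (1 / 2 : ℝ) := by positivity
  have hpos' : 0 ≤ a * δ := by positivity
  rw [hΘ, mul_assoc (1 / 100 : ℝ), hsqrt, ← haδ]
  exact ⟨(ENNReal.ofReal_le_ofReal (by linarith)).trans (hA.le_eLpNorm_velocity_top hδ hσ ha hlow),
    (ENNReal.ofReal_le_ofReal (by linarith)).trans (hA.le_eLpNorm_velocity_two hδ hσ ha hlow),
    (ENNReal.ofReal_le_ofReal (by linarith)).trans (hA.le_eLpNorm_ofAmplitude_top hδ ha hlow),
    (ENNReal.ofReal_le_ofReal (by linarith)).trans (hA.le_eLpNorm_ofAmplitude_two hδ ha hlow)⟩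

theorem le_norms (h : IsSmallParam μ δ) {K : ℝ} (hK : 5000 * K ≤ Real.log |Real.log δ|)
    (hσ : |σ| ≤ 1 / 2) (hχ : IsStripCutoff δ χ) :
    ENNReal.ofReal K ≤ eLpNorm (velocity σ (initialTemp δ χ)) ⊤ volume ∧
      ENNReal.ofReal K ≤ eLpNorm (velocity σ (initialTemp δ χ)) 2 volume ∧
      ENNReal.ofReal K ≤ eLpNorm (initialTemp δ χ) ⊤ volume ∧
      ENNReal.ofReal K ≤ eLpNorm (initialTemp δ χ) 2 volume := by
  have hL := h.loglog_nonneg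
  have hKsup : K ≤ 1 / 5000 * Real.log |Real.log δ| := by linarith
  have hKtwo : K ≤ 1 / 100 * δ ^ (-1 / 2 : ℝ) * Real.log |Real.log δ| := by
    have hone : 1 ≤ δ ^ (-1 / 2 : ℝ) :=
      Real.one_le_rpow_of_pos_of_le_one_of_nonpos h.mem_Ioc.1 (by linarith [h.mem_Ioc.2])
        (by norm_num)
    nlinarith
  obtain ⟨hUsup, hUtwo, hΘsup, hΘtwo⟩ := h.norm_lower_bounds hσ hχ
  exact ⟨(ENNReal.ofReal_le_ofReal hKsup).trans hUsup, (ENNReal.ofReal_le_ofReal hKtwo).trans hUtwo,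
    (ENNReal.ofReal_le_ofReal hKsup).trans hΘsup, (ENNReal.ofReal_le_ofReal hKtwo).trans hΘtwo⟩

end IsSmallParam

end SQG

end

theorem corollary1p3_general (μ : ℝ) (hμ : 0 < μ) :
    ∃ δ₀ : ℝ, 0 < δ₀ ∧
      (∀ δ ∈ Ioc 0 δ₀, ∀ C ≤ 40 * μ, ∀ α, 0 ≤ α → ∀ σ, |σ| ≤ 1 / 2 →
        ∀ χ : SQG.Plane → ℝ, SQG.IsStripCutoff δ χ →
        ∀ g₀ : SQG.Plane → ℝ,
          SQG.sobolevNorm 3 g₀ ^ 2 ≤ ENNReal.ofReal (δ ^ (1 / 2 : ℝ)) →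
          0 < δ ^ (1 / 2 : ℝ) * |Real.log δ| ^ 2 ∧
          δ ^ (1 / 2 : ℝ) * |Real.log δ| ^ 2 ≤ Real.exp (-100) ∧
          SQG.SmallnessCondition C (δ ^ (1 / 2 : ℝ) * |Real.log δ| ^ 2) μ α σ
            (SQG.initialTemp δ χ) g₀ ∧
          ENNReal.ofReal (1 / 5000 * Real.log |Real.log δ|) ≤
            eLpNorm (SQG.velocity σ (SQG.initialTemp δ χ)) ⊤ volume ∧
          ENNReal.ofReal (1 / 100 * δ ^ (-1 / 2 : ℝ) * Real.log |Real.log δ|) ≤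
            eLpNorm (SQG.velocity σ (SQG.initialTemp δ χ)) 2 volume ∧
          ENNReal.ofReal (1 / 5000 * Real.log |Real.log δ|) ≤
            eLpNorm (SQG.initialTemp δ χ) ⊤ volume ∧
          ENNReal.ofReal (1 / 100 * δ ^ (-1 / 2 : ℝ) * Real.log |Real.log δ|) ≤
            eLpNorm (SQG.initialTemp δ χ) 2 volume) ∧
      (∀ K : ℝ, ∃ δ ∈ Ioc 0 δ₀, ∃ χ : SQG.Plane → ℝ, SQG.IsStripCutoff δ χ ∧
        ∀ σ, |σ| ≤ 1 / 2 →
          ENNReal.ofReal K ≤ eLpNorm (SQG.velocity σ (SQG.initialTemp δ χ)) ⊤ volume ∧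
          ENNReal.ofReal K ≤ eLpNorm (SQG.velocity σ (SQG.initialTemp δ χ)) 2 volume ∧
          ENNReal.ofReal K ≤ eLpNorm (SQG.initialTemp δ χ) ⊤ volume ∧
          ENNReal.ofReal K ≤ eLpNorm (SQG.initialTemp δ χ) 2 volume) := by
  obtain ⟨δ₀, hδ₀, hsmall⟩ := mem_nhdsGT_iff_exists_Ioc_subset.1 (SQG.eventually_isSmallParam μ)
  refine ⟨δ₀, hδ₀, fun δ hδ C hCμ α hα σ hσ χ hχ g₀ hg => ?_, fun K => ?_⟩
  · have h : SQG.IsSmallParam μ δ := hsmall hδ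
    exact ⟨h.eps_pos, h.eps_le, h.smallnessCondition hμ hCμ hα hσ hχ hg,
      h.norm_lower_bounds hσ hχ⟩
  · have hlarge := (Real.tendsto_log_atTop.comp SQG.tendsto_abs_log_zero).eventually_ge_atTop
      (5000 * K)
    obtain ⟨δ, hK, hδ⟩ := (hlarge.and (Ioc_mem_nhdsGT hδ₀)).exists
    obtain ⟨χ, hχ⟩ := SQG.exists_isStripCutoff hδ.1
    exact ⟨δ, hδ, χ, hχ, fun σ hσ => (hsmall hδ).le_norms hK hσ hχ⟩

theorem corollary1p3 (μ C : ℝ) (hμ : 0 < μ) (hC : 0 < C) (hCμ : C ≤ 40 * μ) :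
    ∃ δ₀ : ℝ, 0 < δ₀ ∧
      (∀ δ ∈ Set.Ioc 0 δ₀, ∀ α ∈ Set.Ico (0 : ℝ) (1 / 2), ∀ σ ∈ ({-1 / 2, 1 / 2} : Set ℝ),
        ∀ χ : SQG.Plane → ℝ, SQG.IsStripCutoff δ χ →
        ∀ g₀ : SQG.Plane → ℝ,
          SQG.sobolevNorm 3 g₀ ^ 2 ≤ ENNReal.ofReal (δ ^ (1 / 2 : ℝ)) →
          0 < δ ^ (1 / 2 : ℝ) * |Real.log δ| ^ 2 ∧
          δ ^ (1 / 2 : ℝ) * |Real.log δ| ^ 2 ≤ Real.exp (-100) ∧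
          SQG.SmallnessCondition C (δ ^ (1 / 2 : ℝ) * |Real.log δ| ^ 2) μ α σ
            (SQG.initialTemp δ χ) g₀ ∧
          ENNReal.ofReal (1 / 5000 * Real.log |Real.log δ|) ≤
            eLpNorm (SQG.velocity σ (SQG.initialTemp δ χ)) ⊤ volume ∧
          ENNReal.ofReal (1 / 100 * δ ^ (-1 / 2 : ℝ) * Real.log |Real.log δ|) ≤
            eLpNorm (SQG.velocity σ (SQG.initialTemp δ χ)) 2 volume ∧
          ENNReal.ofReal (1 / 5000 * Real.log |Real.log δ|) ≤
            eLpNorm (SQG.initialTemp δ χ) ⊤ volume ∧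
          ENNReal.ofReal (1 / 100 * δ ^ (-1 / 2 : ℝ) * Real.log |Real.log δ|) ≤
            eLpNorm (SQG.initialTemp δ χ) 2 volume) ∧
      (∀ K : ℝ, ∃ δ ∈ Set.Ioc 0 δ₀, ∃ χ : SQG.Plane → ℝ, SQG.IsStripCutoff δ χ ∧
        ∀ σ ∈ ({-1 / 2, 1 / 2} : Set ℝ),
          ENNReal.ofReal K ≤ eLpNorm (SQG.velocity σ (SQG.initialTemp δ χ)) ⊤ volume ∧
          ENNReal.ofReal K ≤ eLpNorm (SQG.velocity σ (SQG.initialTemp δ χ)) 2 volume ∧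
          ENNReal.ofReal K ≤ eLpNorm (SQG.initialTemp δ χ) ⊤ volume ∧
          ENNReal.ofReal K ≤ eLpNorm (SQG.initialTemp δ χ) 2 volume) := by
  have hhalf : ∀ σ ∈ ({-1 / 2, 1 / 2} : Set ℝ), |σ| ≤ 1 / 2 := by
    rintro σ (rfl | rfl) <;> norm_num [abs_div]
  obtain ⟨δ₀, hδ₀, hsmall, hlarge⟩ := corollary1p3_general μ hμ
  refine ⟨δ₀, hδ₀, fun δ hδ α hα σ hσ => hsmall δ hδ C hCμ α hα.1 σ (hhalf σ hσ), fun K => ?_⟩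
  obtain ⟨δ, hδ, χ, hχ, hK⟩ := hlarge K
  exact ⟨δ, hδ, χ, hχ, fun σ hσ => hK σ (hhalf σ hσ)⟩
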